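/- Let $p\in(0,1]$, $M>0$, and let $V_{p,M}(x,\cdot)$, $x\in\mathbb{Z}$, be i.i.d. random variables on a probability space $(\Omega,\mathcal F,\mathbb P)$ with $\mathbb P(V_{p,M}(x,\cdot)=M)=p=1-\mathbb P(V_{p,M}(x,\cdot)=0)$. For fixed $\omega$ let $P^\omega$ be the law of the Markov chain $(S_n)_{n\ge0}$ on $\mathbb Z\cup\{\dagger\}$ with $S_0=0$ which from a site $x\in\mathbb Z$ moves to the absorbing state $\dagger$ with probability $1-e^{-V_{p,M}(x,\omega)}$ and to each of $x+1$ and $x-1$ with probability $\frac12e^{-V_{p,M}(x,\omega)}$. Put $\tau_y=\inf\{n>0:S_n=y\}$ and, for $y\in\mathbb N$, $Q_y^\omega=P^\omega(\,\cdot\mid\tau_y<\infty)$. Then there is a unique deterministic number $v^{\mathrm{que}}_{p,M}\in(0,\infty)$ (depending only on $p$ and $M$), the quenched speed, such that $$\lim_{y\to\infty}\frac{E_{Q_y^\omega}(\tau_y)}{y}=\frac1{v^{\mathrm{que}}_{p,M}}\qquad\text{for }\mathbb P\text{-almost every }\omega ,$$ and it satisfies: 1. for every $M_0>0$, $\displaystyle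 \frac{v^{\mathrm{que}}_{p,M}}{3p/2}\to1$ as $p\to0^+$, uniformly in $M\in[M_0,\infty)$; 2. $\displaystyle \frac{v^{\mathrm{que}}_{p,M}}{3p/(2-p+2p^2)}\to1$ as $M\to\infty$, locally uniformly in $p\in(0,1]$. -/

import Mathlib

universe u

namespace CrossingSpeed

noncomputable section

open MeasureTheory ProbabilityTheory Filter Topology Set
open scoped NNReal ENNReal

/-- The state space `ℤ ∪ {†}`: `some x` is the site `x`, `none` is the absorbing state `†`. -/
abbrev State : Type := Option ℤ

instance : MeasurableSpace State := ⊤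

/-- The one-step distribution of the killed random walk in the potential `V`: from a site `x` the
walk is killed with probability `1 - e^{-V(x)}` and otherwise moves to `x + 1` or `x - 1`, each with
probability `e^{-V(x)} / 2`; the state `†` is absorbing. -/
def stepMeasure (V : ℤ → ℝ≥0) : State → Measure State
  | none => Measure.dirac none
  | some x =>
      ENNReal.ofReal (1 - Real.exp (-(V x : ℝ))) • Measure.dirac none
        + ENNReal.ofReal (Real.exp (-(V x : ℝ)) / 2) • Measure.dirac (some (x + 1))
        + ENNReal.ofReal (Real.exp (-(V x : ℝ)) / 2) • Measure.dirac (some (x - 1))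

/-- The transition kernel of the killed random walk. -/
def stepKernel (V : ℤ → ℝ≥0) : Kernel State State :=
  Kernel.ofFunOfCountable (stepMeasure V)

instance (V : ℤ → ℝ≥0) : IsMarkovKernel (stepKernel V) where
  isProbabilityMeasure s := by
    constructor
    change stepMeasure V s univ = 1
    cases s with
    | none => simp [stepMeasure]
    | some x =>
      have h1 : Real.exp (-(V x : ℝ)) ≤ 1 := Real.exp_le_one_iff.2 (by simp)
      have h0 : 0 < Real.exp (-(V x : ℝ)) := Real.exp_pos _
      simp only [stepMeasure, Measure.add_apply, Measure.smul_apply, measure_univ, smul_eq_mul,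
        mul_one]
      rw [← ENNReal.ofReal_add (by linarith) (by positivity),
        ← ENNReal.ofReal_add (by linarith) (by positivity), ← ENNReal.ofReal_one]
      congr 1
      ring

/-- The transition kernel, seen as a kernel from the history up to time `n` to the state at time
`n + 1`; it only looks at the state at time `n`. -/
def historyKernel (V : ℤ → ℝ≥0) (n : ℕ) :
    Kernel ((i : Finset.Iic n) → (fun _ : ℕ => State) i) State :=
  (stepKernel V).comap (fun h => h ⟨n, Finset.mem_Iic.2 le_rfl⟩) (measurable_pi_apply _)

instance (V : ℤ → ℝ≥0) (n : ℕ) : IsMarkovKernel (historyKernel V n) := by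
  unfold historyKernel
  infer_instance

/-- The path measure `P^ω` of the killed random walk that starts from `0`, in the
potential `V = V(·, ω)`. -/
def pathMeasure (V : ℤ → ℝ≥0) : Measure (ℕ → State) :=
  Kernel.traj (X := fun _ => State) (historyKernel V) 0 (fun _ => some 0)

/-- `τ_x = inf {n > 0 : S_n = x} ∈ ℕ ∪ {∞}`. -/
def hitTime (x : ℤ) (S : ℕ → State) : ℕ∞ :=
  ⨅ (n : ℕ) (_ : 0 < n ∧ S n = some x), (n : ℕ∞)

/-- The quenched path measure `Q_y^ω = P^ω(· | τ_y < ∞)`. -/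
def quenchedMeasure (V : ℤ → ℝ≥0) (y : ℤ) : Measure (ℕ → State) :=
  ProbabilityTheory.cond (pathMeasure V) {S | hitTime y S < ⊤}

/-- The quenched expected crossing time `E_{Q_y^ω}(τ_y) ∈ [0, ∞]`. -/
def meanCrossingTime (V : ℤ → ℝ≥0) (y : ℤ) : ℝ≥0∞ :=
  ∫⁻ S, (hitTime y S : ℝ≥0∞) ∂(quenchedMeasure V y)

/-- `v ∈ (0, ∞)` is the quenched asymptotic speed in the random potential `V`:
almost surely `E_{Q_y^ω}(τ_y) / y → 1 / v` as `y → ∞`. -/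
def IsQuenchedSpeed {Ω : Type*} [MeasurableSpace Ω] (P : Measure Ω) (V : ℤ → Ω → ℝ≥0)
    (v : ℝ) : Prop :=
  0 < v ∧ ∀ᵐ ω ∂P,
    Tendsto (fun y : ℕ => meanCrossingTime (fun x => V x ω) y / (y : ℝ≥0∞)) atTop
      (𝓝 (ENNReal.ofReal (1 / v)))

/-- `V(x, ·)`, `x ∈ ℤ`, are i.i.d. on the probability space `(Ω, P)`, with value `M` with
probability `p` and value `0` with probability `1 - p`. -/
structure IsBernoulliPotential {Ω : Type*} [MeasurableSpace Ω] (P : Measure Ω)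
    (V : ℤ → Ω → ℝ≥0) (p M : ℝ) : Prop where
  measurable : ∀ x, Measurable (V x)
  indep : iIndepFun V P
  prob_eq : ∀ x, P {ω | (V x ω : ℝ) = M} = ENNReal.ofReal p
  prob_zero : ∀ x, P {ω | V x ω = 0} = ENNReal.ofReal (1 - p)

/-- `v` is the quenched speed `v^que_{p,M}`: it is the quenched asymptotic speed in every
realization, on any probability space, of the i.i.d. Bernoulli potential `V_{p,M}`. -/
def IsBernoulliQuenchedSpeed (p M v : ℝ) : Prop :=
  ∀ (Ω : Type u) [MeasurableSpace Ω] (P : Measure Ω) [IsProbabilityMeasure P]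
    (V : ℤ → Ω → ℝ≥0), IsBernoulliPotential P V p M → IsQuenchedSpeed P V v

end

end CrossingSpeed

namespace CrossingSpeed

noncomputable section

open MeasureTheory ProbabilityTheory Filter Topology Set
open scoped NNReal ENNReal

/-! ### Continued fractions -/

/-! Write `α x = e^{-V x}/2`. The walk moves by nearest neighbours, so to reach `y` from `x < y` it
must first reach `x + 1`. The passage probability therefore factorizes as `pass α y x = hit α x *
pass α y (x + 1)`, where `hit α x` depends only on the potential on `(-∞, x]`. Decomposing at the
first step makes `hit` an infinite continued fraction in the rates; its truncation at `n` levels is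
the probability of exiting to the right while using only `n` sites. Conditioned on reaching `y`, the
walk is a nearest-neighbour walk that steps left rather than right at `x` with odds `ret α x = hit α
x * hit α (x - 1)`, whatever `y` is. The mean crossing time of each edge is then the classical
series `crossTime`, and the mean conditional passage time from `0` to `y` is the sum of `crossTime α
x` over `0 ≤ x < y` (`meanCrossingTime_eq_sum`).

In an i.i.d. potential the crossing times are a stationary sequence, so their averages should
converge to the mean of `crossTime` at `0`. The truncated continued fractions give local observables
increasing to `crossTime`. These obey the strong law along residue classes, and Hopf's maximal
inequality transfers the convergence to the limit (`ae_tendsto_birkhoffSum_of_approx`). The inverse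
speed is thus the expectation of `crossTime` at `0`, once this is known to be finite.

That expectation is computed by mass transport. By stationarity, visits to `-k` during the crossing
from `0` to `1` have the same mean as visits to `0` during the crossing from `k` to `k + 1`. Summing
over `k` turns the expected crossing time into the expected Green function at `0`
(`lintegral_crossTime_eq`), which is `1 / (1 - α 0 * (L + R))` with `L`, `R` the probabilities of
reaching `0` from `-1` and `1`. If `0` is free and the nearest obstacles are at `-s` and `t`,
gambler's ruin puts the Green function within `a / (1 - a)`, `a = e^{-M}`, above the harmonic mean
`2st/(s+t)`. If `0` carries an obstacle, it lies between `1` and `1 / (1 - a)`. Averaging over the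
geometric gaps gives `hardCost p ≤ invSpeed p M ≤ hardCost p + a / (1 - a)`, with `hardCost p = (2 -
p + 2p²)/(3p)`. Since `invSpeed p M ≥ 1/(2p)`, an absolute error `e` is a relative error of at most
`2pe`. This is small when `p → 0` with `e` bounded, and also when `e → 0` with `p ≤ 1`, which gives
the two asymptotics. -/

/-- All values lie in `(0, 1/2]`: the jump rates `e^{-V} / 2` of a killed walk. -/
def IsRate {ι : Type*} (β : ι → ℝ) : Prop := ∀ k, 0 < β k ∧ β k ≤ 1 / 2

/-- The finite continued fraction `β₀ / (1 - β₀ β₁ / (1 - ⋯))` with `n` levels. -/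
def contFrac : ℕ → (ℕ → ℝ) → ℝ
  | 0, _ => 0
  | n + 1, β => β 0 / (1 - β 0 * contFrac n (fun k => β (k + 1)))

/-- The infinite continued fraction. -/
def contFracLim (β : ℕ → ℝ) : ℝ := ⨆ n, contFrac n β

lemma IsRate.comp {ι κ : Type*} {β : ι → ℝ} (hβ : IsRate β) (f : κ → ι) :
    IsRate (fun k => β (f k)) := fun k => hβ (f k)

lemma contFrac_mem (n : ℕ) {β : ℕ → ℝ} (hβ : IsRate β) :
    0 ≤ contFrac n β ∧ contFrac n β < 1 := by
  induction n generalizing β with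
  | zero => simp [contFrac]
  | succ n ih =>
    obtain ⟨h0, h1⟩ := ih (hβ.comp (· + 1))
    obtain ⟨b0, b1⟩ := hβ 0
    have hd : 0 < 1 - β 0 * contFrac n (fun k => β (k + 1)) := by nlinarith
    refine ⟨div_nonneg b0.le hd.le, ?_⟩
    rw [contFrac, div_lt_one hd]
    nlinarith

lemma one_sub_rate_mul_pos {b x : ℝ} (hb0 : 0 < b) (hb : b ≤ 1 / 2) (hx1 : x ≤ 1) :
    0 < 1 - b * x := by nlinarith

lemma contFrac_le_succ (n : ℕ) {β : ℕ → ℝ} (hβ : IsRate β) :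
    contFrac n β ≤ contFrac (n + 1) β := by
  induction n generalizing β with
  | zero => exact (contFrac_mem 1 hβ).1
  | succ n ih =>
    have h := ih (hβ.comp (· + 1))
    have h1 := (contFrac_mem (n + 1) (hβ.comp (· + 1))).2
    obtain ⟨b0, b1⟩ := hβ 0
    rw [contFrac, contFrac]
    refine div_le_div_of_nonneg_left b0.le (one_sub_rate_mul_pos b0 b1 h1.le) ?_
    have := mul_le_mul_of_nonneg_left h b0.le
    linarith

lemma contFrac_mono {β : ℕ → ℝ} (hβ : IsRate β) : Monotone (fun n => contFrac n β) :=
  monotone_nat_of_le_succ fun n => contFrac_le_succ n hβ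

lemma bddAbove_contFrac {β : ℕ → ℝ} (hβ : IsRate β) : BddAbove (range fun n => contFrac n β) :=
  ⟨1, by rintro _ ⟨n, rfl⟩; exact (contFrac_mem n hβ).2.le⟩

lemma tendsto_contFrac {β : ℕ → ℝ} (hβ : IsRate β) :
    Tendsto (fun n => contFrac n β) atTop (𝓝 (contFracLim β)) :=
  tendsto_atTop_ciSup (contFrac_mono hβ) (bddAbove_contFrac hβ)

lemma contFrac_le_lim (n : ℕ) {β : ℕ → ℝ} (hβ : IsRate β) : contFrac n β ≤ contFracLim β :=
  le_ciSup (bddAbove_contFrac hβ) n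

lemma contFracLim_le_one {β : ℕ → ℝ} (hβ : IsRate β) : contFracLim β ≤ 1 :=
  ciSup_le fun n => (contFrac_mem n hβ).2.le

lemma contFracLim_eq {β : ℕ → ℝ} (hβ : IsRate β) :
    contFracLim β = β 0 / (1 - β 0 * contFracLim (fun k => β (k + 1))) := by
  have h1 := (tendsto_contFrac hβ).comp (tendsto_add_atTop_nat 1)
  have h2 : Tendsto (fun n => β 0 / (1 - β 0 * contFrac n (fun k => β (k + 1)))) atTop
      (𝓝 (β 0 / (1 - β 0 * contFracLim (fun k => β (k + 1))))) := by
    refine Tendsto.div tendsto_const_nhds ?_ ?_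
    · exact tendsto_const_nhds.sub ((tendsto_contFrac (hβ.comp (· + 1))).const_mul _)
    · exact (one_sub_rate_mul_pos (hβ 0).1 (hβ 0).2 (contFracLim_le_one (hβ.comp (· + 1)))).ne'
  exact tendsto_nhds_unique h1 h2

lemma contFracLim_pos {β : ℕ → ℝ} (hβ : IsRate β) : 0 < contFracLim β := by
  rw [contFracLim_eq hβ]
  exact div_pos (hβ 0).1
    (one_sub_rate_mul_pos (hβ 0).1 (hβ 0).2 (contFracLim_le_one (hβ.comp (· + 1))))

/-- Gambler's ruin. In the coordinate `1 - 1/s`, prepending a free site, `h ↦ 1/(2 - h)`, is the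
translation `s ↦ s + 1`; start from `s = 1`. -/
lemma le_contFrac_of_run {k n : ℕ} {β : ℕ → ℝ} (hβ : IsRate β) (h : ∀ j < k, β j = 1 / 2)
    (hkn : k ≤ n) : 1 - 1 / ((k : ℝ) + 1) ≤ contFrac n β := by
  induction k generalizing n β with
  | zero => simpa using (contFrac_mem n hβ).1
  | succ k ih =>
    obtain ⟨n, rfl⟩ : ∃ m, n = m + 1 := ⟨n - 1, by omega⟩
    have h' := ih (hβ.comp (· + 1)) (fun j hj => h (j + 1) (by omega)) (n := n) (by omega)
    have h1 := (contFrac_mem n (hβ.comp (· + 1))).2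
    rw [contFrac, h 0 (by omega)]
    have hk : (0 : ℝ) < (k : ℝ) + 1 := by positivity
    push_cast
    rw [le_div_iff₀ (by linarith), one_sub_div (by positivity), div_mul_eq_mul_div,
      div_le_iff₀ (by positivity)]
    rw [one_sub_div hk.ne', div_le_iff₀ hk] at h'
    nlinarith

/-- The same translation `s ↦ s + 1` along the free run, now started at the soft obstacle. Bounding
everything beyond it by `1` gives `(a/2)/(1 - a/2)`, which in this coordinate is `s = 1 + a/(2(1 -
a))`. A soft obstacle thus acts like a hard one moved away by `a/(2(1 - a))`. -/
lemma contFrac_le_of_run {k : ℕ} (n : ℕ) {a : ℝ} (ha : 0 < a) (ha1 : a < 1) {β : ℕ → ℝ}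
    (hβ : IsRate β) (h : ∀ j < k, β j = 1 / 2) (hk : β k = a / 2) :
    contFrac n β ≤ 1 - 1 / ((k : ℝ) + 1 + a / (2 * (1 - a))) := by
  have hδ : 0 < a / (2 * (1 - a)) := div_pos ha (by linarith)
  induction n generalizing k β with
  | zero =>
    rw [contFrac, sub_nonneg, div_le_one (by positivity)]
    have : (0 : ℝ) ≤ k := by positivity
    linarith
  | succ n ih =>
    have h1 := (contFrac_mem n (hβ.comp (· + 1))).2
    cases k with
    | zero =>
      have e : 1 - 1 / (((0 : ℕ) : ℝ) + 1 + a / (2 * (1 - a))) = (a / 2) / (1 - a / 2) := by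
        have : 1 - a ≠ 0 := by linarith
        have : 2 - a ≠ 0 := by linarith
        have e1 : 1 + a / (2 * (1 - a)) = (2 - a) / (2 * (1 - a)) := by field_simp; ring
        rw [Nat.cast_zero, zero_add, e1]
        field_simp
        ring
      rw [e, contFrac, hk]
      refine div_le_div_of_nonneg_left (by linarith) (by linarith) ?_
      nlinarith
    | succ k =>
      have h' := ih (hβ.comp (· + 1)) (fun j hj => h (j + 1) (by omega)) hk
      rw [contFrac, h 0 (by omega)]
      push_cast
      have hs : (0 : ℝ) < (k : ℝ) + 1 + a / (2 * (1 - a)) := by positivity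
      have hs' : (0 : ℝ) < (k : ℝ) + 1 + 1 + a / (2 * (1 - a)) := by positivity
      rw [one_sub_div hs.ne', le_div_iff₀ hs] at h'
      rw [div_le_iff₀ (by linarith), one_sub_div hs'.ne', div_mul_eq_mul_div, le_div_iff₀ hs']
      nlinarith

/-! ### Crossing times in a deterministic environment -/

/-- The probability of reaching `z + 1` from `z`, for jump rates `α`. -/
def hit (α : ℤ → ℝ) (z : ℤ) : ℝ := contFracLim (fun k : ℕ => α (z - k))

/-- The ratio of the Green functions of consecutive sites. -/
def ret (α : ℤ → ℝ) (z : ℤ) : ℝ := hit α z * hit α (z - 1)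

/-- The mean number of visits to `z - k` while crossing from `z` to `z + 1`. -/
def crossTerm (α : ℤ → ℝ) (z : ℤ) (k : ℕ) : ℝ :=
  (1 + ret α (z - k)) * ∏ j ∈ Finset.range k, ret α (z - j)

/-- The mean conditional crossing time from `z` to `z + 1`. -/
def crossTime (α : ℤ → ℝ) (z : ℤ) : ℝ≥0∞ := ∑' k, ENNReal.ofReal (crossTerm α z k)

variable {α : ℤ → ℝ}

lemma hit_pos (hα : IsRate α) (z : ℤ) : 0 < hit α z := contFracLim_pos (hα.comp _)

lemma hit_le_one (hα : IsRate α) (z : ℤ) : hit α z ≤ 1 := contFracLim_le_one (hα.comp _)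

lemma one_sub_mul_hit_pos (hα : IsRate α) (x z : ℤ) : 0 < 1 - α x * hit α z :=
  one_sub_rate_mul_pos (hα x).1 (hα x).2 (hit_le_one hα z)

lemma hit_eq (hα : IsRate α) (z : ℤ) : hit α z = α z / (1 - α z * hit α (z - 1)) := by
  have h := contFracLim_eq (hα.comp (fun k : ℕ => z - (k : ℤ)))
  simp only [Nat.cast_zero, sub_zero, Nat.cast_add, Nat.cast_one] at h
  rw [hit, h, hit]
  congr 4
  ext k
  congr 1
  ring

lemma contFrac_succ_left (α : ℤ → ℝ) (n : ℕ) (z : ℤ) :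
    contFrac (n + 1) (fun k : ℕ => α (z - k)) =
      α z / (1 - α z * contFrac n (fun k : ℕ => α (z - 1 - k))) := by
  rw [contFrac]
  simp only [Nat.cast_zero, sub_zero, Nat.cast_add, Nat.cast_one]
  congr 4
  ext k
  congr 1
  ring

lemma contFrac_succ_right (α : ℤ → ℝ) (n : ℕ) (z : ℤ) :
    contFrac (n + 1) (fun k : ℕ => α (z + k)) =
      α z / (1 - α z * contFrac n (fun k : ℕ => α (z + 1 + k))) := by
  rw [contFrac]
  simp only [Nat.cast_zero, add_zero, Nat.cast_add, Nat.cast_one]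
  congr 4
  ext k
  congr 1
  ring

lemma ret_pos (hα : IsRate α) (z : ℤ) : 0 < ret α z := mul_pos (hit_pos hα _) (hit_pos hα _)

/-- The conditioned walk at `z` steps left with probability `α z * hit α (z - 1)`, so `1 + ret` is
the inverse of its probability of stepping right. -/
lemma one_add_ret (hα : IsRate α) (z : ℤ) : 1 + ret α z = 1 / (1 - α z * hit α (z - 1)) := by
  have := (one_sub_mul_hit_pos hα z (z - 1)).ne'
  rw [ret, hit_eq hα z]
  field_simp
  ring

lemma crossTerm_pos (hα : IsRate α) (z : ℤ) (k : ℕ) : 0 < crossTerm α z k :=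
  mul_pos (by linarith [ret_pos hα (z - k)]) (Finset.prod_pos fun _ _ => ret_pos hα _)

lemma crossTerm_zero (α : ℤ → ℝ) (z : ℤ) : crossTerm α z 0 = 1 + ret α z := by simp [crossTerm]

lemma crossTerm_succ (α : ℤ → ℝ) (z : ℤ) (k : ℕ) :
    crossTerm α z (k + 1) = ret α z * crossTerm α (z - 1) k := by
  rw [crossTerm, crossTerm, Finset.prod_range_succ']
  have : ∀ j : ℕ, z - ((j + 1 : ℕ) : ℤ) = z - 1 - j := fun j => by push_cast; ring
  simp only [this, Nat.cast_zero, sub_zero]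
  ring

lemma sum_crossTerm_succ (α : ℤ → ℝ) (n : ℕ) (z : ℤ) :
    ∑ k ∈ Finset.range (n + 1), crossTerm α z k =
      1 + ret α z + ret α z * ∑ k ∈ Finset.range n, crossTerm α (z - 1) k := by
  rw [Finset.sum_range_succ', crossTerm_zero, Finset.mul_sum]
  simp only [crossTerm_succ]
  ring

lemma crossTime_eq_iSup (hα : IsRate α) (z : ℤ) :
    crossTime α z = ⨆ n, ENNReal.ofReal (∑ k ∈ Finset.range n, crossTerm α z k) := by
  rw [crossTime, ENNReal.tsum_eq_iSup_nat]
  congr 1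
  ext n
  rw [ENNReal.ofReal_sum_of_nonneg fun k _ => (crossTerm_pos hα z k).le]

/-! ### First passage probabilities -/

/-- The probability that the walk with jump rates `α` started at `x` first visits `y` at time
`n`. -/
def firstPass (α : ℤ → ℝ) (y : ℤ) : ℕ → ℤ → ℝ
  | 0, x => if x = y then 1 else 0
  | n + 1, x => if x = y then 0 else α x * (firstPass α y n (x + 1) + firstPass α y n (x - 1))

/-- The probability of visiting `y` from `x`. -/
def pass (α : ℤ → ℝ) (y x : ℤ) : ℝ := ∑' n, firstPass α y n x

/-- The expectation of the first passage time to `y` from `x`, on the event that it is finite. -/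
def meanPass (α : ℤ → ℝ) (y x : ℤ) : ℝ≥0∞ := ∑' n : ℕ, ENNReal.ofReal (n * firstPass α y n x)

lemma firstPass_nonneg (hα : IsRate α) (y : ℤ) (n : ℕ) (x : ℤ) : 0 ≤ firstPass α y n x := by
  induction n generalizing x with
  | zero => rw [firstPass]; split_ifs <;> simp
  | succ n ih =>
    rw [firstPass]
    split_ifs
    · exact le_rfl
    · exact mul_nonneg (hα x).1.le (add_nonneg (ih _) (ih _))

lemma sum_firstPass_succ (α : ℤ → ℝ) {x y : ℤ} (hxy : x ≠ y) (N : ℕ) :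
    ∑ n ∈ Finset.range (N + 1), firstPass α y n x =
      α x * (∑ n ∈ Finset.range N, firstPass α y n (x + 1) +
        ∑ n ∈ Finset.range N, firstPass α y n (x - 1)) := by
  rw [Finset.sum_range_succ']
  simp only [firstPass, hxy, if_false, add_zero]
  rw [← Finset.mul_sum, Finset.sum_add_distrib]

lemma sum_firstPass_mono (hα : IsRate α) (y x : ℤ) :
    Monotone fun N => ∑ n ∈ Finset.range N, firstPass α y n x :=
  monotone_nat_of_le_succ fun N => by
    rw [Finset.sum_range_succ]
    linarith [firstPass_nonneg hα y N x]

lemma sum_firstPass_nonneg (hα : IsRate α) (y x : ℤ) (N : ℕ) :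
    0 ≤ ∑ n ∈ Finset.range N, firstPass α y n x :=
  Finset.sum_nonneg fun n _ => firstPass_nonneg hα y n x

lemma sum_firstPass_le_one (hα : IsRate α) (y : ℤ) (N : ℕ) (x : ℤ) :
    ∑ n ∈ Finset.range N, firstPass α y n x ≤ 1 := by
  induction N generalizing x with
  | zero => simp
  | succ N ih =>
    by_cases hxy : x = y
    · subst hxy
      rw [Finset.sum_range_succ']
      simp [firstPass]
    · rw [sum_firstPass_succ α hxy]
      have h1 := ih (x + 1)
      have h2 := ih (x - 1)
      have := hα x
      have := sum_firstPass_nonneg hα y (x + 1) N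
      have := sum_firstPass_nonneg hα y (x - 1) N
      nlinarith

lemma summable_firstPass (hα : IsRate α) (y x : ℤ) : Summable fun n => firstPass α y n x :=
  summable_of_sum_range_le (fun n => firstPass_nonneg hα y n x)
    fun N => sum_firstPass_le_one hα y N x

lemma sum_firstPass_le_pass (hα : IsRate α) (y x : ℤ) (N : ℕ) :
    ∑ n ∈ Finset.range N, firstPass α y n x ≤ pass α y x :=
  (summable_firstPass hα y x).sum_le_tsum _ fun n _ => firstPass_nonneg hα y n x

lemma pass_nonneg (hα : IsRate α) (y x : ℤ) : 0 ≤ pass α y x :=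
  tsum_nonneg fun n => firstPass_nonneg hα y n x

lemma pass_self (hα : IsRate α) (y : ℤ) : pass α y y = 1 := by
  rw [pass, (summable_firstPass hα y y).tsum_eq_zero_add]
  simp [firstPass]

lemma pass_eq (hα : IsRate α) {x y : ℤ} (hxy : x ≠ y) :
    pass α y x = α x * (pass α y (x + 1) + pass α y (x - 1)) := by
  have h := ((summable_firstPass hα y x).hasSum.tendsto_sum_nat).comp (tendsto_add_atTop_nat 1)
  have h' := ((summable_firstPass hα y (x + 1)).hasSum.tendsto_sum_nat.add
    (summable_firstPass hα y (x - 1)).hasSum.tendsto_sum_nat).const_mul (α x)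
  refine tendsto_nhds_unique (h.congr fun N => ?_) h'
  exact sum_firstPass_succ α hxy N

/-- Truncation in time matters: the one-step recursion alone has further solutions, growing to the
left, and the finite-time sums single out the minimal one. Each extra time step pays for one more
level of the continued fraction. -/
lemma sum_firstPass_le_contFrac_mul (hα : IsRate α) (y : ℤ) (N : ℕ) {x : ℤ} (hxy : x < y) :
    ∑ n ∈ Finset.range N, firstPass α y n x ≤
      contFrac N (fun k : ℕ => α (x - k)) * ∑ n ∈ Finset.range N, firstPass α y n (x + 1) := by
  induction N generalizing x with
  | zero => simp
  | succ N ih =>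
    have h := ih (x := x - 1) (by omega)
    rw [sub_add_cancel] at h
    have e := sum_firstPass_succ α hxy.ne N
    have m1 := sum_firstPass_mono hα y (x + 1) N.le_succ
    have m2 := sum_firstPass_mono hα y x N.le_succ
    have hc := contFrac_mem N (hα.comp (fun k : ℕ => x - 1 - (k : ℤ)))
    have hd := one_sub_rate_mul_pos (hα x).1 (hα x).2 hc.2.le
    rw [contFrac_succ_left, div_mul_eq_mul_div, le_div_iff₀ hd]
    simp only [Nat.succ_eq_add_one] at m1 m2
    have m3 := mul_le_mul_of_nonneg_left m2 hc.1
    have m4 := mul_le_mul_of_nonneg_left (add_le_add m1 (h.trans m3)) (hα x).1.le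
    linarith

/-- The matching lower bound: the left side discards the paths that use more than `n` sites to the
left before reaching `x + 1`. -/
lemma contFrac_mul_le_pass (hα : IsRate α) (y : ℤ) (n : ℕ) {x : ℤ} (hxy : x < y) :
    contFrac n (fun k : ℕ => α (x - k)) * pass α y (x + 1) ≤ pass α y x := by
  induction n generalizing x with
  | zero => simpa [contFrac] using pass_nonneg hα y x
  | succ n ih =>
    have h := ih (x := x - 1) (by omega)
    rw [sub_add_cancel] at h
    have e := pass_eq hα hxy.ne
    have hc := contFrac_mem n (hα.comp (fun k : ℕ => x - 1 - (k : ℤ)))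
    have hd := one_sub_rate_mul_pos (hα x).1 (hα x).2 hc.2.le
    rw [contFrac_succ_left, div_mul_eq_mul_div, div_le_iff₀ hd]
    have m4 := mul_le_mul_of_nonneg_left h (hα x).1.le
    linarith

lemma tendsto_contFrac_hit (hα : IsRate α) (x : ℤ) :
    Tendsto (fun n => contFrac n (fun k : ℕ => α (x - k))) atTop (𝓝 (hit α x)) :=
  tendsto_contFrac (hα.comp _)

lemma pass_eq_hit_mul (hα : IsRate α) {x y : ℤ} (hxy : x < y) :
    pass α y x = hit α x * pass α y (x + 1) := by
  refine le_antisymm ?_ ?_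
  · exact le_of_tendsto_of_tendsto (summable_firstPass hα y x).hasSum.tendsto_sum_nat
      ((tendsto_contFrac_hit hα x).mul (summable_firstPass hα y (x + 1)).hasSum.tendsto_sum_nat)
      (Eventually.of_forall fun N => sum_firstPass_le_contFrac_mul hα y N hxy)
  · exact le_of_tendsto' ((tendsto_contFrac_hit hα x).mul_const _)
      fun n => contFrac_mul_le_pass hα y n hxy

lemma pass_pos (hα : IsRate α) (y : ℤ) (m : ℕ) : 0 < pass α y (y - m) := by
  induction m with
  | zero => simp [pass_self hα]
  | succ m ih =>
    rw [pass_eq_hit_mul hα (by push_cast; omega)]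
    have : y - ((m + 1 : ℕ) : ℤ) + 1 = y - m := by push_cast; ring
    rw [this]
    exact mul_pos (hit_pos hα _) ih

/-! ### Mean passage times -/

/-- First-step decomposition with `n + 1` split as `n` plus `1`; the `1` yields the inhomogeneous
last sum. -/
lemma sum_mul_firstPass_succ (α : ℤ → ℝ) {x y : ℤ} (hxy : x ≠ y) (N : ℕ) :
    ∑ n ∈ Finset.range (N + 1), (n : ℝ) * firstPass α y n x =
      α x * (∑ n ∈ Finset.range N, (n : ℝ) * firstPass α y n (x + 1) +
        ∑ n ∈ Finset.range N, (n : ℝ) * firstPass α y n (x - 1)) +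
      ∑ n ∈ Finset.range (N + 1), firstPass α y n x := by
  rw [Finset.sum_range_succ', Finset.sum_range_succ' (fun n => firstPass α y n x)]
  simp only [firstPass, hxy, if_false, Nat.cast_zero, zero_mul, add_zero]
  rw [← Finset.sum_add_distrib, Finset.mul_sum, ← Finset.sum_add_distrib]
  refine Finset.sum_congr rfl fun n _ => ?_
  push_cast
  ring

lemma sum_mul_firstPass_mono (hα : IsRate α) (y x : ℤ) :
    Monotone fun N => ∑ n ∈ Finset.range N, (n : ℝ) * firstPass α y n x :=
  monotone_nat_of_le_succ fun N => by
    rw [Finset.sum_range_succ]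
    linarith [mul_nonneg N.cast_nonneg (firstPass_nonneg hα y N x)]

/-- Insert the bound at `x - 1` into the first-step recursion and solve for the sum at `x`. The
resulting coefficients are exactly the recursions of `hit` and of the partial sums of `crossTerm`.
Working with sums truncated in time keeps everything finite before the limit. -/
lemma sum_mul_firstPass_le (hα : IsRate α) (y : ℤ) (N : ℕ) {x : ℤ} (hxy : x < y) :
    ∑ n ∈ Finset.range N, (n : ℝ) * firstPass α y n x ≤
      hit α x * ∑ n ∈ Finset.range N, (n : ℝ) * firstPass α y n (x + 1) +
        (∑ k ∈ Finset.range N, crossTerm α x k) * pass α y x := by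
  induction N generalizing x with
  | zero => simp
  | succ N ih =>
    have h := ih (x := x - 1) (by omega)
    rw [sub_add_cancel, pass_eq_hit_mul hα (by omega), sub_add_cancel] at h
    have e := sum_mul_firstPass_succ α hxy.ne N
    have m1 := sum_mul_firstPass_mono hα y (x + 1) N.le_succ
    have m2 := sum_mul_firstPass_mono hα y x N.le_succ
    have m0 := sum_firstPass_le_pass hα y x (N + 1)
    have hd := one_sub_mul_hit_pos hα x (x - 1)
    simp only [Nat.succ_eq_add_one] at m1 m2
    have m3 := mul_le_mul_of_nonneg_left m2 (hit_pos hα (x - 1)).le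
    have m4 := mul_le_mul_of_nonneg_left (add_le_add m1 (h.trans (add_le_add_left m3 _)))
      (hα x).1.le
    rw [sum_crossTerm_succ, one_add_ret hα, ret, hit_eq hα x]
    set W' := ∑ n ∈ Finset.range (N + 1), (n : ℝ) * firstPass α y n x
    set W1 := ∑ n ∈ Finset.range (N + 1), (n : ℝ) * firstPass α y n (x + 1)
    set S := ∑ k ∈ Finset.range N, crossTerm α (x - 1) k
    set p := pass α y x
    set H := hit α (x - 1)
    have : α x / (1 - α x * H) * W1 + (1 / (1 - α x * H) + α x / (1 - α x * H) * H * S) * p =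
        (α x * W1 + (1 + α x * H * S) * p) / (1 - α x * H) := by
      field_simp
    rw [this, le_div_iff₀ hd]
    linarith

lemma meanPass_self (α : ℤ → ℝ) (y : ℤ) : meanPass α y y = 0 := by
  rw [meanPass, ENNReal.tsum_eq_zero]
  intro n
  cases n <;> simp [firstPass]

lemma meanPass_eq (hα : IsRate α) {x y : ℤ} (hxy : x ≠ y) :
    meanPass α y x = ENNReal.ofReal (α x) * (meanPass α y (x + 1) + meanPass α y (x - 1)) +
      ENNReal.ofReal (pass α y x) := by
  have hp : ENNReal.ofReal (pass α y x) = ∑' n, ENNReal.ofReal (firstPass α y (n + 1) x) := by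
    have hs : Summable fun n => firstPass α y (n + 1) x :=
      (summable_nat_add_iff (f := fun n => firstPass α y n x) 1).2 (summable_firstPass hα y x)
    have h0 : firstPass α y 0 x = 0 := by simp [firstPass, hxy]
    rw [pass, (summable_firstPass hα y x).tsum_eq_zero_add, h0, zero_add,
      ENNReal.ofReal_tsum_of_nonneg (fun n => firstPass_nonneg hα y (n + 1) x) hs]
  have hm : meanPass α y x =
      ∑' n : ℕ, ENNReal.ofReal (((n + 1 : ℕ) : ℝ) * firstPass α y (n + 1) x) := by
    have := tsum_eq_zero_add' (f := fun n : ℕ => ENNReal.ofReal ((n : ℝ) * firstPass α y n x))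
      ENNReal.summable
    rw [meanPass, this]
    simp
  rw [hp, hm]
  simp only [meanPass]
  rw [← ENNReal.tsum_add, ← ENNReal.tsum_mul_left, ← ENNReal.tsum_add]
  refine tsum_congr fun n => ?_
  have h1 := firstPass_nonneg hα y n (x + 1)
  have h2 := firstPass_nonneg hα y n (x - 1)
  have h3 := firstPass_nonneg hα y (n + 1) x
  have h0 := (hα x).1
  rw [← ENNReal.ofReal_add (by positivity) (by positivity), ← ENNReal.ofReal_mul h0.le,
    ← ENNReal.ofReal_add (by positivity) h3]
  congr 1
  simp only [firstPass, hxy, if_false]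
  push_cast
  ring

/-- The induction step for lower bounds: a bound at `x - 1` is put into the first-step equation,
which is then solved for the value at `x`. Solving requires subtraction, so the case of infinite
mean is separated first. -/
lemma le_meanPass_of_le (hα : IsRate α) {x y : ℤ} (hxy : x < y) {κ s : ℝ} (hκ0 : 0 ≤ κ)
    (hκ : κ ≤ 1) (hs : 0 ≤ s)
    (h : ENNReal.ofReal κ * meanPass α y x + ENNReal.ofReal s ≤ meanPass α y (x - 1)) :
    ENNReal.ofReal (α x / (1 - α x * κ)) * meanPass α y (x + 1) +
      ENNReal.ofReal ((pass α y x + α x * s) / (1 - α x * κ)) ≤ meanPass α y x := by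
  have h0 := (hα x).1
  have hd := one_sub_rate_mul_pos h0 (hα x).2 hκ
  have hp := pass_nonneg hα y x
  by_cases htop : meanPass α y x = ∞
  · rw [htop]; exact le_top
  have e := meanPass_eq hα hxy.ne
  have hα0 : ENNReal.ofReal (α x) ≠ 0 := by simpa using h0
  have hfin : meanPass α y (x + 1) + meanPass α y (x - 1) ≠ ∞ := by
    intro ht
    rw [ht, ENNReal.mul_top hα0] at e
    exact htop (by rw [e]; simp)
  obtain ⟨f1, f2⟩ := ENNReal.add_ne_top.1 hfin
  rw [← ENNReal.ofReal_toReal htop, ← ENNReal.ofReal_toReal f1, ← ENNReal.ofReal_toReal f2] at e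
  rw [← ENNReal.ofReal_toReal htop, ← ENNReal.ofReal_toReal f2] at h
  rw [← ENNReal.ofReal_toReal htop, ← ENNReal.ofReal_toReal f1]
  set w := (meanPass α y x).toReal
  set w1 := (meanPass α y (x + 1)).toReal
  set w2 := (meanPass α y (x - 1)).toReal
  have hw : 0 ≤ w := ENNReal.toReal_nonneg
  have hw1 : 0 ≤ w1 := ENNReal.toReal_nonneg
  have hw2 : 0 ≤ w2 := ENNReal.toReal_nonneg
  rw [← ENNReal.ofReal_add hw1 hw2, ← ENNReal.ofReal_mul h0.le,
    ← ENNReal.ofReal_add (by positivity) hp,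
    ENNReal.ofReal_eq_ofReal_iff hw (by positivity)] at e
  rw [← ENNReal.ofReal_mul hκ0, ← ENNReal.ofReal_add (by positivity) hs,
    ENNReal.ofReal_le_ofReal_iff hw2] at h
  have hq : 0 ≤ α x / (1 - α x * κ) := div_nonneg h0.le hd.le
  have hr : 0 ≤ (pass α y x + α x * s) / (1 - α x * κ) := div_nonneg (by positivity) hd.le
  rw [← ENNReal.ofReal_mul hq, ← ENNReal.ofReal_add (by positivity) hr]
  refine ENNReal.ofReal_le_ofReal ?_
  rw [div_mul_eq_mul_div, ← add_div, div_le_iff₀ hd]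
  have := mul_le_mul_of_nonneg_left h h0.le
  linarith

lemma contFrac_mul_le_meanPass (hα : IsRate α) (y : ℤ) (n : ℕ) {x : ℤ} (hxy : x < y) :
    ENNReal.ofReal (contFrac n (fun k : ℕ => α (x - k))) * meanPass α y (x + 1) ≤
      meanPass α y x := by
  induction n generalizing x with
  | zero => simp [contFrac]
  | succ n ih =>
    have h := ih (x := x - 1) (by omega)
    rw [sub_add_cancel] at h
    have hc := contFrac_mem n (hα.comp (fun k : ℕ => x - 1 - (k : ℤ)))
    rw [contFrac_succ_left]
    refine le_trans le_self_add (le_meanPass_of_le hα hxy hc.1 hc.2.le le_rfl ?_)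
    simpa using h

lemma hit_mul_le_meanPass (hα : IsRate α) {x y : ℤ} (hxy : x < y) :
    ENNReal.ofReal (hit α x) * meanPass α y (x + 1) ≤ meanPass α y x := by
  refine le_of_tendsto' (ENNReal.Tendsto.mul_const
    (ENNReal.tendsto_ofReal (tendsto_contFrac_hit hα x)) (Or.inl ?_))
    fun n => contFrac_mul_le_meanPass hα y n hxy
  simpa using hit_pos hα x

/-- Each application of `le_meanPass_of_le` adds one term of the crossing series. Starting with the
full `hit` rather than its truncation keeps the homogeneous coefficient fixed, so only the series
remains to be sent to its limit. -/
lemma hit_mul_add_le_meanPass (hα : IsRate α) (y : ℤ) (n : ℕ) {x : ℤ} (hxy : x < y) :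
    ENNReal.ofReal (hit α x) * meanPass α y (x + 1) +
      ENNReal.ofReal ((∑ k ∈ Finset.range n, crossTerm α x k) * pass α y x) ≤
      meanPass α y x := by
  induction n generalizing x with
  | zero => simpa using hit_mul_le_meanPass hα hxy
  | succ n ih =>
    have h := ih (x := x - 1) (by omega)
    rw [sub_add_cancel] at h
    have hs : 0 ≤ (∑ k ∈ Finset.range n, crossTerm α (x - 1) k) * pass α y (x - 1) :=
      mul_nonneg (Finset.sum_nonneg fun k _ => (crossTerm_pos hα _ k).le) (pass_nonneg hα _ _)
    convert! le_meanPass_of_le hα hxy (hit_pos hα (x - 1)).le (hit_le_one hα _) hs h using 3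
    · rw [← hit_eq hα x]
    · have hd := (one_sub_mul_hit_pos hα x (x - 1)).ne'
      rw [sum_crossTerm_succ, one_add_ret hα, ret, hit_eq hα x,
        pass_eq_hit_mul hα (x := x - 1) (by omega), sub_add_cancel]
      field_simp

lemma meanPass_eq_hit_mul_add (hα : IsRate α) {x y : ℤ} (hxy : x < y) :
    meanPass α y x = ENNReal.ofReal (hit α x) * meanPass α y (x + 1) +
      crossTime α x * ENNReal.ofReal (pass α y x) := by
  refine le_antisymm ?_ ?_
  · rw [meanPass, ENNReal.tsum_eq_iSup_nat]
    refine iSup_le fun N => ?_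
    have hn : ∀ z : ℤ, ∀ n : ℕ, 0 ≤ (n : ℝ) * firstPass α y n z := fun z n =>
      mul_nonneg n.cast_nonneg (firstPass_nonneg hα y n z)
    have hs : 0 ≤ ∑ k ∈ Finset.range N, crossTerm α x k :=
      Finset.sum_nonneg fun k _ => (crossTerm_pos hα _ k).le
    rw [← ENNReal.ofReal_sum_of_nonneg fun n _ => hn x n]
    refine (ENNReal.ofReal_le_ofReal (sum_mul_firstPass_le hα y N hxy)).trans ?_
    refine ENNReal.ofReal_add_le.trans (add_le_add ?_ ?_)
    · rw [ENNReal.ofReal_mul (hit_pos hα x).le, meanPass,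
        ENNReal.ofReal_sum_of_nonneg fun n _ => hn (x + 1) n]
      gcongr
      exact ENNReal.sum_le_tsum _
    · rw [ENNReal.ofReal_mul hs, crossTime_eq_iSup hα]
      gcongr
      exact le_iSup (fun n => ENNReal.ofReal (∑ k ∈ Finset.range n, crossTerm α x k)) N
  · rw [crossTime_eq_iSup hα, ENNReal.iSup_mul, ENNReal.add_iSup]
    refine iSup_le fun n => ?_
    rw [← ENNReal.ofReal_mul (Finset.sum_nonneg fun k _ => (crossTerm_pos hα _ k).le)]
    exact hit_mul_add_le_meanPass hα y n hxy

lemma meanPass_eq_sum_mul_pass (hα : IsRate α) (y : ℤ) (m : ℕ) :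
    meanPass α y (y - m) =
      (∑ i ∈ Finset.range m, crossTime α (y - ((i + 1 : ℕ) : ℤ))) *
        ENNReal.ofReal (pass α y (y - m)) := by
  induction m with
  | zero => simp [meanPass_self]
  | succ m ih =>
    have e : y - ((m + 1 : ℕ) : ℤ) + 1 = y - m := by push_cast; ring
    have hlt : y - ((m + 1 : ℕ) : ℤ) < y := by push_cast; omega
    rw [meanPass_eq_hit_mul_add hα hlt, e, ih, Finset.sum_range_succ, add_mul]
    congr 1
    rw [pass_eq_hit_mul hα hlt, e, ENNReal.ofReal_mul (hit_pos hα _).le]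
    ring

/-- The mean passage time from `0` to `y` is the sum of the mean crossing times of the edges. -/
lemma meanPass_zero (hα : IsRate α) (y : ℕ) :
    meanPass α y 0 =
      (∑ x ∈ Finset.range y, crossTime α x) * ENNReal.ofReal (pass α y 0) := by
  have h := meanPass_eq_sum_mul_pass hα y y
  rw [sub_self] at h
  rw [h, ← Finset.sum_range_reflect (fun x : ℕ => crossTime α x)]
  congr 1
  refine Finset.sum_congr rfl fun i hi => ?_
  have := Finset.mem_range.1 hi
  congr 1
  omega

/-! ### The path measure -/

/-- The jump rates of the killed walk in the potential `V`. -/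
def rate (V : ℤ → ℝ≥0) (x : ℤ) : ℝ := Real.exp (-(V x : ℝ)) / 2

lemma isRate_rate (V : ℤ → ℝ≥0) : IsRate (rate V) := fun x => by
  have h1 : Real.exp (-(V x : ℝ)) ≤ 1 := Real.exp_le_one_iff.2 (by simp)
  have h0 : 0 < Real.exp (-(V x : ℝ)) := Real.exp_pos _
  exact ⟨by unfold rate; linarith, by unfold rate; linarith⟩

lemma lintegral_stepMeasure_some (V : ℤ → ℝ≥0) (φ : State → ℝ≥0∞) (x : ℤ) :
    ∫⁻ s, φ s ∂(stepMeasure V (some x)) =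
      ENNReal.ofReal (1 - Real.exp (-(V x : ℝ))) * φ none +
        ENNReal.ofReal (rate V x) * φ (some (x + 1)) +
        ENNReal.ofReal (rate V x) * φ (some (x - 1)) := by
  have hφ : Measurable φ := fun _ _ => trivial
  rw [stepMeasure, lintegral_add_measure, lintegral_add_measure, lintegral_smul_measure,
    lintegral_smul_measure, lintegral_smul_measure, lintegral_dirac' _ hφ, lintegral_dirac' _ hφ,
    lintegral_dirac' _ hφ]
  rfl

lemma lintegral_stepMeasure_none (V : ℤ → ℝ≥0) (φ : State → ℝ≥0∞) :
    ∫⁻ s, φ s ∂(stepMeasure V none) = φ none :=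
  lintegral_dirac' _ (fun _ _ => trivial)

instance (V : ℤ → ℝ≥0) : IsProbabilityMeasure (pathMeasure V) := by
  unfold pathMeasure
  infer_instance

/-- The one-step Markov property of the path measure. -/
lemma lintegral_pathMeasure_step (V : ℤ → ℝ≥0) (n : ℕ) {G : (ℕ → State) → ℝ≥0∞}
    (hG : Measurable G) (hdep : ∀ S S' : ℕ → State, (∀ k ≤ n, S k = S' k) → G S = G S')
    (φ : State → ℝ≥0∞) :
    ∫⁻ S, G S * φ (S (n + 1)) ∂(pathMeasure V) =
      ∫⁻ S, G S * ∫⁻ s, φ s ∂(stepMeasure V (S n)) ∂(pathMeasure V) := by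
  -- A history is extended to a whole path by the filler value `none`. By `hdep`, `G` does not see
  -- the filler, so `G` becomes a function of the history alone and the composition-product formula
  -- applies.
  let ext : ((i : Finset.Iic n) → State) → ℕ → State :=
    fun h k => if hk : k ≤ n then h ⟨k, Finset.mem_Iic.2 hk⟩ else none
  have hext : Measurable ext := by
    refine measurable_pi_lambda _ fun k => ?_
    by_cases hk : k ≤ n
    · simp only [ext, hk, dif_pos]; exact measurable_pi_apply _
    · simp only [ext, hk, dif_neg, not_false_eq_true]; exact measurable_const
  have hGe : ∀ S : ℕ → State, G S = G (ext (Preorder.frestrictLe n S)) := fun S =>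
    hdep _ _ fun k hk => by simp [ext, hk, Preorder.frestrictLe]
  have hφ : Measurable φ := fun _ _ => trivial
  have hK : Measurable fun s => ∫⁻ s', φ s' ∂(stepMeasure V s) := fun _ _ => trivial
  have key := Kernel.partialTraj_compProd_eq_map_traj (X := fun _ => State)
    (κ := historyKernel V) (a := 0) (b := n) (Nat.zero_le n) (x₀ := fun _ => some 0)
  have hF : Measurable fun q : ((i : Finset.Iic n) → State) × State => G (ext q.1) * φ q.2 :=
    (hG.comp (hext.comp measurable_fst)).mul (hφ.comp measurable_snd)
  have hm : Measurable fun S : ℕ → State =>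
      (Preorder.frestrictLe (π := fun _ => State) n S, S (n + 1)) :=
    (Preorder.measurable_frestrictLe n).prodMk (measurable_pi_apply _)
  have hlast : Measurable fun h : (i : Finset.Iic n) → State =>
      ∫⁻ s, φ s ∂(stepMeasure V (h ⟨n, Finset.mem_Iic.2 le_rfl⟩)) :=
    hK.comp (measurable_pi_apply _)
  calc ∫⁻ S, G S * φ (S (n + 1)) ∂(pathMeasure V)
      = ∫⁻ q, G (ext q.1) * φ q.2 ∂((pathMeasure V).map fun S : ℕ → State =>
          (Preorder.frestrictLe (π := fun _ => State) n S, S (n + 1))) := by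
        rw [lintegral_map hF hm]
        exact lintegral_congr fun S => by rw [hGe S]
    _ = ∫⁻ h, ∫⁻ s, G (ext h) * φ s ∂(historyKernel V n h)
          ∂(Kernel.partialTraj (X := fun _ => State) (historyKernel V) 0 n
            (fun _ => some 0)) := by
        rw [pathMeasure, ← key, Measure.lintegral_compProd hF]
    _ = ∫⁻ h, G (ext h) * ∫⁻ s, φ s ∂(stepMeasure V (h ⟨n, Finset.mem_Iic.2 le_rfl⟩))
          ∂(Kernel.partialTraj (X := fun _ => State) (historyKernel V) 0 n
            (fun _ => some 0)) := by
        refine lintegral_congr fun h => ?_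
        rw [lintegral_const_mul _ hφ]
        rfl
    _ = _ := by
        have hGl : Measurable fun h : (i : Finset.Iic n) → State => G (ext h) *
            ∫⁻ s, φ s ∂(stepMeasure V (h ⟨n, Finset.mem_Iic.2 le_rfl⟩)) :=
          (hG.comp hext).mul hlast
        rw [← Kernel.traj_map_frestrictLe_apply,
          lintegral_map hGl (Preorder.measurable_frestrictLe n)]
        refine lintegral_congr fun S => ?_
        rw [← hGe S]
        rfl

lemma measurableSet_eval_eq {ι : Type*} (k : ι) (s : State) :
    MeasurableSet {S : ι → State | S k = s} := by
  have h : {S : ι → State | S k = s} = (fun S : ι → State => S k) ⁻¹' {s} := by ext; simp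
  rw [h]
  exact measurable_pi_apply k trivial

lemma pathMeasure_zero (V : ℤ → ℝ≥0) : ∀ᵐ S ∂(pathMeasure V), S 0 = some 0 := by
  have h := Kernel.traj_map_frestrictLe_apply (X := fun _ => State) (κ := historyKernel V)
    0 0 (fun _ => some 0)
  rw [Kernel.partialTraj_self, Kernel.id_apply] at h
  have hs : MeasurableSet {h : (i : Finset.Iic 0) → State |
      h ⟨0, Finset.mem_Iic.2 le_rfl⟩ = some 0} :=
    measurableSet_eval_eq _ _
  have h2 : ∀ᵐ x ∂((pathMeasure V).map (Preorder.frestrictLe (π := fun _ => State) 0)),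
      x ⟨0, Finset.mem_Iic.2 le_rfl⟩ = some 0 := by
    rw [pathMeasure, h, ae_dirac_iff hs]
  exact ae_of_ae_map (Preorder.measurable_frestrictLe 0).aemeasurable h2

/-- The probability that the walk started at `s` first visits `y` at time `n`. -/
def statePass (V : ℤ → ℝ≥0) (y : ℤ) (n : ℕ) : State → ℝ≥0∞
  | none => 0
  | some x => ENNReal.ofReal (firstPass (rate V) y n x)

lemma lintegral_statePass (V : ℤ → ℝ≥0) (y : ℤ) (n : ℕ) {s : State} (hs : s ≠ some y) :
    ∫⁻ s', statePass V y n s' ∂(stepMeasure V s) = statePass V y (n + 1) s := by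
  cases s with
  | none => rw [lintegral_stepMeasure_none]; rfl
  | some x =>
    have hx : x ≠ y := fun h => hs (by rw [h])
    have hα := isRate_rate V
    rw [lintegral_stepMeasure_some]
    simp only [statePass, mul_zero, zero_add, firstPass, hx, if_false]
    rw [ENNReal.ofReal_mul (hα x).1.le, ENNReal.ofReal_add (firstPass_nonneg hα _ _ _)
      (firstPass_nonneg hα _ _ _), mul_add]

/-- The paths that avoid `y` up to time `n`. -/
def avoid (y : ℤ) (n : ℕ) : Set (ℕ → State) := {S | ∀ k ≤ n, S k ≠ some y}

lemma measurableSet_avoid (y : ℤ) (n : ℕ) : MeasurableSet (avoid y n) := by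
  have : avoid y n = ⋂ k ≤ n, (fun S : ℕ → State => S k) ⁻¹' {some y}ᶜ := by
    ext S; simp [avoid]
  rw [this]
  exact MeasurableSet.iInter fun k => MeasurableSet.iInter fun _ =>
    measurable_pi_apply k (show MeasurableSet ({some y}ᶜ : Set State) from trivial)

lemma lintegral_avoid_step (V : ℤ → ℝ≥0) (y : ℤ) (n j : ℕ) :
    ∫⁻ S, (avoid y n).indicator 1 S * statePass V y (j + 1) (S n) ∂(pathMeasure V) =
      ∫⁻ S, (avoid y n).indicator 1 S * statePass V y j (S (n + 1)) ∂(pathMeasure V) := by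
  rw [lintegral_pathMeasure_step V n (measurable_one.indicator (measurableSet_avoid y n))]
  · refine lintegral_congr fun S => ?_
    by_cases hS : S ∈ avoid y n
    · rw [lintegral_statePass V y j (hS n le_rfl)]
    · simp [hS]
  · intro S S' h
    have : S ∈ avoid y n ↔ S' ∈ avoid y n :=
      forall₂_congr fun k hk => by rw [h k hk]
    by_cases hS : S ∈ avoid y n
    · rw [indicator_of_mem hS, indicator_of_mem (this.1 hS)]; rfl
    · rw [indicator_of_notMem hS, indicator_of_notMem (mt this.2 hS)]

/-- A martingale identity: on the event that `y` has not been visited, the conditional probability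
of a first visit at the fixed time `n + j + 1` has constant mean as the walk evolves. -/
lemma lintegral_avoid (V : ℤ → ℝ≥0) (y : ℤ) (n j : ℕ) :
    ∫⁻ S, (avoid y 0).indicator 1 S * statePass V y (n + j + 1) (S 0) ∂(pathMeasure V) =
      ∫⁻ S, (avoid y n).indicator 1 S * statePass V y (j + 1) (S n) ∂(pathMeasure V) := by
  induction n generalizing j with
  | zero => rw [zero_add]
  | succ n ih =>
    rw [show n + 1 + j + 1 = n + (j + 1) + 1 by ring, ih (j + 1), lintegral_avoid_step]
    refine lintegral_congr fun S => ?_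
    -- Enlarging the avoided times from `n` to `n + 1` is free: starting at `y`, the first visit
    -- cannot occur at the positive time `j + 1`. This is why the remaining time is written as a
    -- successor.
    by_cases hy : S (n + 1) = some y
    · rw [hy]; simp [statePass, firstPass]
    · have : S ∈ avoid y n ↔ S ∈ avoid y (n + 1) :=
        ⟨fun h k hk => (Nat.lt_or_eq_of_le hk).elim (fun h' => h k (by omega))
          (fun h' => h' ▸ hy), fun h k hk => h k (by omega)⟩
      by_cases hS : S ∈ avoid y n
      · rw [indicator_of_mem hS, indicator_of_mem (this.1 hS)]
      · rw [indicator_of_notMem hS, indicator_of_notMem (mt this.2 hS)]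

lemma hitTime_eq_iff (y : ℤ) (S : ℕ → State) (n : ℕ) :
    hitTime y S = n ↔ (0 < n ∧ S n = some y) ∧ ∀ k, 0 < k → k < n → S k ≠ some y := by
  classical
  by_cases hex : ∃ m, 0 < m ∧ S m = some y
  · have h : hitTime y S = (Nat.find hex : ℕ) := by
      refine le_antisymm (iInf₂_le (Nat.find hex) (Nat.find_spec hex)) (le_iInf₂ fun m hm => ?_)
      exact_mod_cast Nat.find_min' hex hm
    rw [h, Nat.cast_inj, Nat.find_eq_iff]
    refine and_congr_right fun _ => forall_congr' fun k => ?_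
    tauto
  · have h : hitTime y S = ⊤ := by
      simp only [hitTime, iInf_eq_top]
      exact fun m hm => (hex ⟨m, hm⟩).elim
    rw [h]
    constructor
    · intro h; exact absurd h.symm (ENat.natCast_ne_top n)
    · intro h; exact (hex ⟨n, h.1⟩).elim

lemma measurableSet_hitTime_eq (y : ℤ) (n : ℕ) : MeasurableSet {S | hitTime y S = n} := by
  have hm : ∀ k, MeasurableSet {S : ℕ → State | S k = some y} := fun k =>
    measurableSet_eval_eq k _
  by_cases hn : 0 < n
  · have : {S | hitTime y S = n} = {S : ℕ → State | S n = some y} ∩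
        ⋂ k : ℕ, ⋂ _ : 0 < k, ⋂ _ : k < n, {S : ℕ → State | S k = some y}ᶜ := by
      ext S
      simp [hitTime_eq_iff, hn]
    rw [this]
    exact (hm n).inter (MeasurableSet.iInter fun k => MeasurableSet.iInter fun _ =>
      MeasurableSet.iInter fun _ => (hm k).compl)
  · have : {S | hitTime y S = n} = ∅ := by
      ext S
      simp [hitTime_eq_iff, hn]
    rw [this]
    exact MeasurableSet.empty

/-- `hitTime` ignores time `0` whereas `firstPass` counts it; the two agree because the walk starts
at `0 ≠ y`. -/
lemma pathMeasure_hitTime_eq (V : ℤ → ℝ≥0) {y : ℤ} (hy : y ≠ 0) (n : ℕ) :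
    pathMeasure V {S | hitTime y S = n} = ENNReal.ofReal (firstPass (rate V) y n 0) := by
  cases n with
  | zero =>
    have : {S : ℕ → State | hitTime y S = (0 : ℕ)} = ∅ := by
      ext S; simp only [hitTime_eq_iff]; simp
    rw [this]
    simp [firstPass, hy.symm]
  | succ n =>
    have hy' : (some 0 : State) ≠ some y := fun h => hy (Option.some.inj h).symm
    have h0 := lintegral_avoid V y n 0
    rw [add_zero, lintegral_avoid_step V y n 0] at h0
    have e1 : ∫⁻ S, (avoid y 0).indicator 1 S * statePass V y (n + 1) (S 0) ∂(pathMeasure V) =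
        ENNReal.ofReal (firstPass (rate V) y (n + 1) 0) := by
      rw [lintegral_congr_ae (g := fun _ => statePass V y (n + 1) (some 0)), lintegral_const,
        measure_univ, mul_one]
      · rfl
      · filter_upwards [pathMeasure_zero V] with S hS
        have : S ∈ avoid y 0 := fun k hk => by
          rw [Nat.le_zero.1 hk, hS]; exact hy'
        simp [this, hS]
    rw [← e1, h0, ← lintegral_indicator_one (measurableSet_hitTime_eq y _)]
    refine lintegral_congr_ae ?_
    filter_upwards [pathMeasure_zero V] with S hS
    have hiff : S ∈ {S | hitTime y S = (n + 1 : ℕ)} ↔ S ∈ avoid y n ∧ S (n + 1) = some y := by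
      rw [mem_ofPred_eq, hitTime_eq_iff]
      constructor
      · rintro ⟨⟨-, h1⟩, h2⟩
        refine ⟨fun k hk => ?_, h1⟩
        rcases Nat.eq_zero_or_pos k with rfl | hk0
        · rw [hS]; exact hy'
        · exact h2 k hk0 (by omega)
      · rintro ⟨h1, h2⟩
        exact ⟨⟨by omega, h2⟩, fun k _ hk => h1 k (by omega)⟩
    have hsp : statePass V y 0 (S (n + 1)) = if S (n + 1) = some y then 1 else 0 := by
      cases hx : S (n + 1) with
      | none => simp [statePass]
      | some x =>
        by_cases hxy : x = y
        · simp [statePass, firstPass, hxy]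
        · have : (some x : State) ≠ some y := fun h => hxy (Option.some.inj h)
          simp [statePass, firstPass, hxy, this]
    rw [hsp]
    by_cases hmem : S ∈ {S | hitTime y S = (n + 1 : ℕ)}
    · obtain ⟨h1, h2⟩ := hiff.1 hmem
      rw [indicator_of_mem hmem, indicator_of_mem h1, if_pos h2]
      simp
    · rw [indicator_of_notMem hmem]
      by_cases h1 : S ∈ avoid y n
      · rw [if_neg fun h2 => hmem (hiff.2 ⟨h1, h2⟩), mul_zero]
      · rw [indicator_of_notMem h1, zero_mul]

lemma hitTime_lt_top_eq_iUnion (y : ℤ) :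
    {S : ℕ → State | hitTime y S < ⊤} = ⋃ n : ℕ, {S | hitTime y S = n} := by
  ext S
  simp only [mem_ofPred_eq, mem_iUnion, lt_top_iff_ne_top, ENat.ne_top_iff_exists]
  exact exists_congr fun n => eq_comm

lemma pairwise_disjoint_hitTime (y : ℤ) :
    Pairwise (Function.onFun Disjoint fun n : ℕ => {S : ℕ → State | hitTime y S = n}) := by
  intro m n hmn
  refine Set.disjoint_left.2 fun S h1 h2 => hmn ?_
  have : (m : ℕ∞) = n := h1.symm.trans h2
  exact_mod_cast this

lemma pathMeasure_hitTime_lt_top (V : ℤ → ℝ≥0) {y : ℤ} (hy : y ≠ 0) :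
    pathMeasure V {S | hitTime y S < ⊤} = ENNReal.ofReal (pass (rate V) y 0) := by
  have hα := isRate_rate V
  rw [hitTime_lt_top_eq_iUnion, measure_iUnion (pairwise_disjoint_hitTime y)
    (measurableSet_hitTime_eq y), pass, ENNReal.ofReal_tsum_of_nonneg
    (fun n => firstPass_nonneg hα y n 0) (summable_firstPass hα y 0)]
  exact tsum_congr fun n => pathMeasure_hitTime_eq V hy n

lemma setLIntegral_hitTime (V : ℤ → ℝ≥0) {y : ℤ} (hy : y ≠ 0) :
    ∫⁻ S in {S | hitTime y S < ⊤}, (hitTime y S : ℝ≥0∞) ∂(pathMeasure V) =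
      meanPass (rate V) y 0 := by
  rw [hitTime_lt_top_eq_iUnion, lintegral_iUnion (measurableSet_hitTime_eq y)
    (pairwise_disjoint_hitTime y), meanPass]
  refine tsum_congr fun n => ?_
  rw [setLIntegral_congr_fun (g := fun _ => (n : ℝ≥0∞)) (measurableSet_hitTime_eq y n),
    setLIntegral_const, pathMeasure_hitTime_eq V hy, ENNReal.ofReal_mul n.cast_nonneg,
    ENNReal.ofReal_natCast]
  intro S hS
  have : hitTime y S = n := hS
  simp [this]

/-- The mean crossing time is a sum of mean crossing times of single edges. -/
lemma meanCrossingTime_eq_sum (V : ℤ → ℝ≥0) {y : ℕ} (hy : y ≠ 0) :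
    meanCrossingTime V y = ∑ x ∈ Finset.range y, crossTime (rate V) x := by
  have hy' : (y : ℤ) ≠ 0 := by exact_mod_cast hy
  have hpos : 0 < pass (rate V) y 0 := by
    simpa using pass_pos (isRate_rate V) (y : ℤ) y
  rw [meanCrossingTime, quenchedMeasure, ProbabilityTheory.cond, lintegral_smul_measure,
    setLIntegral_hitTime V hy', pathMeasure_hitTime_lt_top V hy', meanPass_zero (isRate_rate V),
    smul_eq_mul, mul_comm, mul_assoc, ENNReal.mul_inv_cancel (by simpa using hpos) (by simp),
    mul_one]

/-! ### The maximal ergodic inequality and its consequences -/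

section Maximal

variable {X : Type*}

/-- The running maximum of the Birkhoff sums of orders `0, …, n`. -/
def maxBirkhoff (θ : X → X) (f : X → ℝ) : ℕ → X → ℝ
  | 0, _ => 0
  | n + 1, x => max 0 (f x + maxBirkhoff θ f n (θ x))

lemma maxBirkhoff_nonneg (θ : X → X) (f : X → ℝ) (n : ℕ) (x : X) : 0 ≤ maxBirkhoff θ f n x := by
  cases n with
  | zero => exact le_rfl
  | succ n => exact le_max_left _ _

lemma maxBirkhoff_mono (θ : X → X) (f : X → ℝ) (x : X) :
    Monotone fun n => maxBirkhoff θ f n x := by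
  refine monotone_nat_of_le_succ fun n => ?_
  induction n generalizing x with
  | zero => exact maxBirkhoff_nonneg _ _ _ _
  | succ n ih =>
    rw [maxBirkhoff, maxBirkhoff]
    exact max_le_max le_rfl (add_le_add le_rfl (ih (θ x)))

lemma birkhoffSum_le_maxBirkhoff (θ : X → X) (f : X → ℝ) (n : ℕ) (x : X) :
    birkhoffSum θ f n x ≤ maxBirkhoff θ f n x := by
  induction n generalizing x with
  | zero => simp [maxBirkhoff]
  | succ n ih =>
    rw [birkhoffSum_succ', maxBirkhoff]
    exact le_max_of_le_right (add_le_add le_rfl (ih (θ x)))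

variable [MeasurableSpace X] {μ : Measure X} {θ : X → X}

lemma measurable_maxBirkhoff (hθ : Measurable θ) {f : X → ℝ} (hf : Measurable f) (n : ℕ) :
    Measurable (maxBirkhoff θ f n) := by
  induction n with
  | zero => exact measurable_const
  | succ n ih => exact measurable_const.max (hf.add (ih.comp hθ))

lemma integrable_maxBirkhoff [IsFiniteMeasure μ] (hθ : MeasurePreserving θ μ μ) {f : X → ℝ}
    (hf : Integrable f μ) (n : ℕ) : Integrable (maxBirkhoff θ f n) μ := by
  induction n with
  | zero => exact integrable_const 0
  | succ n ih =>
    exact (integrable_const (0 : ℝ)).sup (hf.add (hθ.integrable_comp_of_integrable ih))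

/-- Hopf's maximal ergodic lemma. -/
lemma setIntegral_maxBirkhoff_nonneg [IsFiniteMeasure μ] (hθ : MeasurePreserving θ μ μ)
    {f : X → ℝ} (hfm : Measurable f) (hf : Integrable f μ) (n : ℕ) :
    0 ≤ ∫ x in {x | 0 < maxBirkhoff θ f n x}, f x ∂μ := by
  set g := maxBirkhoff θ f n with hg
  have hgm : Measurable g := measurable_maxBirkhoff hθ.measurable hfm n
  have hgi : Integrable g μ := integrable_maxBirkhoff hθ hf n
  have hgθ : Integrable (fun x => g (θ x)) μ := hθ.integrable_comp_of_integrable hgi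
  set A := {x | 0 < g x}
  have hA : MeasurableSet A := measurableSet_lt measurable_const hgm
  -- Garsia's argument: where the running maximum is positive it equals `f` plus the shorter maximum
  -- at `θ x`, hence is at most `f x + g (θ x)`. Integrating over `A` and using invariance finishes
  -- the proof.
  have h1 : ∀ x ∈ A, g x - g (θ x) ≤ f x := by
    intro x hx
    have hx' : 0 < maxBirkhoff θ f n x := hx
    cases n with
    | zero => exact absurd hx' (lt_irrefl _)
    | succ n =>
      rw [maxBirkhoff, lt_max_iff] at hx'
      have hpos := hx'.resolve_left (lt_irrefl _)
      have e : g x = f x + maxBirkhoff θ f n (θ x) := by rw [hg, maxBirkhoff, max_eq_right hpos.le]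
      have := maxBirkhoff_mono θ f (θ x) n.le_succ
      simp only [Nat.succ_eq_add_one] at this
      rw [e, hg]
      linarith
  have h2 : ∫ x in A, g x ∂μ = ∫ x, g x ∂μ := by
    refine setIntegral_eq_integral_of_forall_compl_eq_zero fun x hx => ?_
    have h : ¬ 0 < g x := hx
    exact le_antisymm (not_lt.1 h) (maxBirkhoff_nonneg _ _ _ _)
  have h3 : ∫ x in A, g (θ x) ∂μ ≤ ∫ x, g (θ x) ∂μ :=
    setIntegral_le_integral hgθ (Eventually.of_forall fun x => maxBirkhoff_nonneg _ _ _ _)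
  have h4 : ∫ x, g (θ x) ∂μ = ∫ x, g x ∂μ := by
    have := integral_map (μ := μ) (φ := θ) hθ.measurable.aemeasurable
      (f := g) hgm.aestronglyMeasurable
    rw [hθ.map_eq] at this
    exact this.symm
  calc (0 : ℝ) ≤ ∫ x in A, g x ∂μ - ∫ x in A, g (θ x) ∂μ := by rw [h2]; linarith
    _ = ∫ x in A, (g x - g (θ x)) ∂μ :=
        (integral_sub hgi.integrableOn hgθ.integrableOn).symm
    _ ≤ ∫ x in A, f x ∂μ :=
        setIntegral_mono_on (hgi.sub hgθ).integrableOn hf.integrableOn hA h1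

/-- The maximal ergodic inequality for nonnegative functions. -/
lemma measure_exists_lt_birkhoffSum_le [IsFiniteMeasure μ] (hθ : MeasurePreserving θ μ μ)
    {f : X → ℝ} (hfm : Measurable f) (hf : Integrable f μ) (hf0 : 0 ≤ᵐ[μ] f) {c : ℝ}
    (hc : 0 < c) :
    μ {x | ∃ k : ℕ, c * k < birkhoffSum θ f k x} ≤ ENNReal.ofReal ((∫ x, f x ∂μ) / c) := by
  set f' : X → ℝ := fun x => f x - c
  have hf' : Integrable f' μ := hf.sub (integrable_const c)
  have hfm' : Measurable f' := hfm.sub_const c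
  set A : ℕ → Set X := fun n => {x | 0 < maxBirkhoff θ f' n x}
  have hA : ∀ n, μ (A n) ≤ ENNReal.ofReal ((∫ x, f x ∂μ) / c) := by
    intro n
    have h := setIntegral_maxBirkhoff_nonneg hθ hfm' hf' n
    have h1 : ∫ x in A n, f' x ∂μ = ∫ x in A n, f x ∂μ - μ.real (A n) * c := by
      rw [integral_sub hf.integrableOn (integrable_const c), setIntegral_const, smul_eq_mul]
    have h2 : ∫ x in A n, f x ∂μ ≤ ∫ x, f x ∂μ := setIntegral_le_integral hf hf0
    have h3 : μ.real (A n) ≤ (∫ x, f x ∂μ) / c := by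
      rw [le_div_iff₀ hc]
      have : 0 ≤ ∫ x in A n, f' x ∂μ := h
      linarith
    rw [← ENNReal.ofReal_toReal (measure_ne_top μ (A n))]
    exact ENNReal.ofReal_le_ofReal h3
  have hsub : {x | ∃ k : ℕ, c * k < birkhoffSum θ f k x} ⊆ ⋃ n, A n := by
    rintro x ⟨k, hk⟩
    refine mem_iUnion.2 ⟨k, ?_⟩
    have h1 := birkhoffSum_le_maxBirkhoff θ f' k x
    have h2 : birkhoffSum θ f' k x = birkhoffSum θ f k x - c * k := by
      simp only [birkhoffSum, f', Finset.sum_sub_distrib, Finset.sum_const, Finset.card_range,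
        nsmul_eq_mul]
      ring
    exact lt_of_lt_of_le (by linarith) h1
  refine (measure_mono hsub).trans ?_
  have hmono : Monotone A := fun m n hmn x hx =>
    lt_of_lt_of_le (show 0 < maxBirkhoff θ f' m x from hx) (maxBirkhoff_mono θ f' x hmn)
  rw [hmono.measure_iUnion]
  exact iSup_le hA

/-- Almost sure convergence of Birkhoff averages is inherited by increasing limits in `L¹`. -/
lemma ae_tendsto_birkhoffSum_of_approx [IsFiniteMeasure μ] (hθ : MeasurePreserving θ μ μ)
    {F : X → ℝ} (hFm : Measurable F) (hF : Integrable F μ) {f : ℕ → X → ℝ}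
    (hfm : ∀ n, Measurable (f n)) (hf : ∀ n, Integrable (f n) μ) (hle : ∀ n, f n ≤ᵐ[μ] F)
    (hlim : Tendsto (fun n => ∫ x, f n x ∂μ) atTop (𝓝 (∫ x, F x ∂μ)))
    (hconv : ∀ n, ∀ᵐ x ∂μ, Tendsto (fun y : ℕ => birkhoffSum θ (f n) y x / y) atTop
      (𝓝 (∫ x, f n x ∂μ))) :
    ∀ᵐ x ∂μ, Tendsto (fun y : ℕ => birkhoffSum θ F y x / y) atTop (𝓝 (∫ x, F x ∂μ)) := by
  set c := ∫ x, F x ∂μ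
  have hcn : ∀ n, ∫ x, f n x ∂μ ≤ c := fun n => integral_mono_ae (hf n) hF (hle n)
  -- If the averages of `F` exceed `c + 2ε` infinitely often while those of `f n` are eventually
  -- below `c + ε`, some Birkhoff sum of the nonnegative `F - f n` exceeds `ε * y`. The maximal
  -- inequality bounds the probability of this by `(c - ∫ f n) / ε`, which tends to `0`. The lower
  -- bound needs only `f n ≤ F`.
  have hupper : ∀ ε : ℝ, 0 < ε →
      ∀ᵐ x ∂μ, ∀ᶠ y : ℕ in atTop, birkhoffSum θ F y x ≤ (c + 2 * ε) * y := by
    intro ε hε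
    rw [ae_iff]
    have hb : ∀ n, μ {x | ¬ ∀ᶠ y : ℕ in atTop, birkhoffSum θ F y x ≤ (c + 2 * ε) * y} ≤
        ENNReal.ofReal ((c - ∫ x, f n x ∂μ) / ε) := by
      intro n
      have hmax := measure_exists_lt_birkhoffSum_le hθ (hFm.sub (hfm n)) (hF.sub (hf n))
        (by filter_upwards [hle n] with x hx; simpa using hx) hε
      have hint : ∫ x, (F - f n) x ∂μ = c - ∫ x, f n x ∂μ := integral_sub hF (hf n)
      rw [hint] at hmax
      refine le_trans (measure_mono_ae ?_) hmax
      filter_upwards [hconv n] with x hx hx'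
      have hev : ∀ᶠ y : ℕ in atTop, birkhoffSum θ (f n) y x / y < c + ε :=
        hx.eventually_lt_const (by linarith [hcn n])
      have hfr : ∃ᶠ y : ℕ in atTop, ¬ birkhoffSum θ F y x ≤ (c + 2 * ε) * y :=
        not_eventually.1 hx'
      obtain ⟨y, hy1, hy2, hy3⟩ := (hfr.and_eventually (hev.and (eventually_gt_atTop 0))).exists
      refine ⟨y, ?_⟩
      have hy0 : (0 : ℝ) < y := by exact_mod_cast hy3
      rw [div_lt_iff₀ hy0] at hy2
      have e := birkhoffSum_sub θ F (f n) y x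
      rw [e]
      have := not_le.1 hy1
      nlinarith
    have hz : Tendsto (fun n => ENNReal.ofReal ((c - ∫ x, f n x ∂μ) / ε)) atTop (𝓝 0) := by
      have h1 : Tendsto (fun n => (c - ∫ x, f n x ∂μ) / ε) atTop (𝓝 ((c - c) / ε)) :=
        (tendsto_const_nhds.sub hlim).div_const ε
      simpa using ENNReal.tendsto_ofReal h1
    exact le_antisymm (ge_of_tendsto' hz hb) zero_le
  have hU : ∀ᵐ x ∂μ, ∀ j : ℕ, ∀ᶠ y : ℕ in atTop,
      birkhoffSum θ F y x ≤ (c + 2 * (1 / ((j : ℝ) + 1))) * y :=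
    ae_all_iff.2 fun j => hupper _ (by positivity)
  have hle' : ∀ᵐ x ∂μ, ∀ n k : ℕ, f n (θ^[k] x) ≤ F (θ^[k] x) :=
    ae_all_iff.2 fun n => ae_all_iff.2 fun k =>
      (hθ.iterate k).quasiMeasurePreserving.ae (hle n)
  filter_upwards [hU, hle', ae_all_iff.2 hconv] with x hx1 hx2 hx3
  refine tendsto_order.2 ⟨fun b hb => ?_, fun b hb => ?_⟩
  · obtain ⟨n, hn⟩ := (hlim.eventually_const_lt hb).exists
    filter_upwards [(hx3 n).eventually_const_lt hn] with y hy
    refine hy.trans_le ?_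
    have : birkhoffSum θ (f n) y x ≤ birkhoffSum θ F y x :=
      Finset.sum_le_sum fun k _ => hx2 n k
    gcongr
  · obtain ⟨j, hj⟩ := exists_nat_one_div_lt (show (0 : ℝ) < (b - c) / 2 by linarith)
    filter_upwards [hx1 j, eventually_gt_atTop 0] with y hy hy0
    have hy0' : (0 : ℝ) < y := by exact_mod_cast hy0
    rw [div_lt_iff₀ hy0']
    nlinarith

end Maximal

/-! ### The shift of an i.i.d. field -/

/-- The shift of a field on `ℤ`. -/
def shift (V : ℤ → ℝ≥0) : ℤ → ℝ≥0 := fun x => V (x + 1)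

lemma shift_iterate (k : ℕ) (V : ℤ → ℝ≥0) : shift^[k] V = fun x => V (x + k) := by
  induction k generalizing V with
  | zero => simp
  | succ k ih =>
    rw [Function.iterate_succ_apply, ih]
    ext x
    simp only [shift]
    congr 2
    push_cast
    ring

variable {ν : Measure ℝ≥0} [IsProbabilityMeasure ν]

lemma measurePreserving_shift (ν : Measure ℝ≥0) [IsProbabilityMeasure ν] :
    MeasurePreserving shift (Measure.infinitePi fun _ : ℤ => ν)
      (Measure.infinitePi fun _ : ℤ => ν) where
  measurable := measurable_pi_lambda _ fun _ => measurable_pi_apply _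
  map_eq := Measure.map_infinitePi_infinitePi_of_inj (P := fun _ : ℤ => ν)
    (f := fun x : ℤ => x + 1) (add_left_injective 1)

/-- The two observables read the windows `[p - w, p]` and `[q - w, q]`, which are disjoint because
`p + w < q`. -/
lemma indepFun_shift_iterate {f : (ℤ → ℝ≥0) → ℝ} (hf : Measurable f) {w : ℕ}
    (hdep : ∀ V V' : ℤ → ℝ≥0, (∀ x, -(w : ℤ) ≤ x → x ≤ 0 → V x = V' x) → f V = f V')
    {p q : ℕ} (hpq : p + w < q) :
    IndepFun (fun V => f (shift^[p] V)) (fun V => f (shift^[q] V))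
      (Measure.infinitePi fun _ : ℤ => ν) := by
  let S : ℕ → Finset ℤ := fun p => Finset.Icc ((p : ℤ) - w) p
  let ext : (p : ℕ) → (S p → ℝ≥0) → ℤ → ℝ≥0 := fun p h x =>
    if hx : x + p ∈ S p then h ⟨x + p, hx⟩ else 0
  have hext : ∀ p, Measurable (ext p) := fun p => by
    refine measurable_pi_lambda _ fun x => ?_
    by_cases hx : x + p ∈ S p
    · simp only [ext, hx, dif_pos]; exact measurable_pi_apply _
    · simp only [ext, hx, dif_neg, not_false_eq_true]; exact measurable_const
  have hfac : ∀ p, (fun V => f (shift^[p] V)) =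
      (fun h => f (ext p h)) ∘ fun (V : ℤ → ℝ≥0) (i : S p) => V i := by
    intro p
    ext V
    refine hdep _ _ fun x h1 h2 => ?_
    have hx : x + p ∈ S p := Finset.mem_Icc.2 ⟨by omega, by omega⟩
    simp [shift_iterate, ext, hx]
  have hdisj : Disjoint (S p) (S q) := by
    rw [Finset.disjoint_left]
    intro x h1 h2
    have := Finset.mem_Icc.1 h1
    have := Finset.mem_Icc.1 h2
    omega
  have hind : iIndepFun (fun (i : ℤ) (V : ℤ → ℝ≥0) => V i)
      (Measure.infinitePi fun _ : ℤ => ν) :=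
    iIndepFun_infinitePi (P := fun _ : ℤ => ν) (X := fun _ x => x) fun _ => measurable_id
  rw [hfac p, hfac q]
  exact (hind.indepFun_finset (S p) (S q) hdisj fun i => measurable_pi_apply i).comp
    (hf.comp (hext p)) (hf.comp (hext q))

/-- The strong law of large numbers for the shifts of a local observable. -/
lemma ae_tendsto_birkhoffSum_shift_of_local {f : (ℤ → ℝ≥0) → ℝ} (hf : Measurable f)
    (hf0 : ∀ V, 0 ≤ f V) (hint : Integrable f (Measure.infinitePi fun _ : ℤ => ν)) {w : ℕ}
    (hdep : ∀ V V' : ℤ → ℝ≥0, (∀ x, -(w : ℤ) ≤ x → x ≤ 0 → V x = V' x) → f V = f V') :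
    ∀ᵐ V ∂(Measure.infinitePi fun _ : ℤ => ν),
      Tendsto (fun y : ℕ => birkhoffSum shift f y V / y) atTop
        (𝓝 (∫ V, f V ∂(Measure.infinitePi fun _ : ℤ => ν))) := by
  set μ := Measure.infinitePi fun _ : ℤ => ν
  have hθ := measurePreserving_shift ν
  -- Times in the same residue class modulo `w + 1` read disjoint windows, so the strong law applies
  -- to each class separately.
  set m := w + 1
  have hident : ∀ p, IdentDistrib (fun V => f (shift^[p] V)) f μ μ := fun p =>
    { aemeasurable_fst := (hf.comp (hθ.iterate p).measurable).aemeasurable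
      aemeasurable_snd := hf.aemeasurable
      map_eq := by
        have h : (fun V => f (shift^[p] V)) = f ∘ shift^[p] := rfl
        rw [h, ← Measure.map_map hf (hθ.iterate p).measurable, (hθ.iterate p).map_eq] }
  have hslln : ∀ r : ℕ, ∀ᵐ V ∂μ, Tendsto
      (fun n : ℕ => (∑ i ∈ Finset.range n, f (shift^[i * m + r] V)) / n) atTop
      (𝓝 (∫ V, f V ∂μ)) := by
    intro r
    have h := strong_law_ae_real (μ := μ) (fun (i : ℕ) V => f (shift^[i * m + r] V))
      ((hident _).integrable_iff.2 hint) ?_ fun i => (hident _).trans (hident _).symm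
    · have e : ∫ V, f (shift^[0 * m + r] V) ∂μ = ∫ V, f V ∂μ := (hident _).integral_eq
      rw [e] at h
      exact h
    · have hlt : ∀ i j : ℕ, i < j → IndepFun (fun V => f (shift^[i * m + r] V))
          (fun V => f (shift^[j * m + r] V)) μ := by
        intro i j hij
        refine indepFun_shift_iterate hf hdep ?_
        have : (i + 1) * m ≤ j * m := Nat.mul_le_mul_right _ hij
        rw [add_mul] at this
        omega
      intro i j hij
      rcases lt_or_gt_of_ne hij with h | h
      · exact hlt i j h
      · exact (hlt j i h).symm
  filter_upwards [ae_all_iff.2 hslln] with V hV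
  have hblock : ∀ n : ℕ, birkhoffSum shift f (n * m) V =
      ∑ r ∈ Finset.range m, ∑ i ∈ Finset.range n, f (shift^[i * m + r] V) := by
    intro n
    induction n with
    | zero => simp
    | succ n ih =>
      simp only [Finset.sum_range_succ, Finset.sum_add_distrib]
      rw [← ih, add_mul, one_mul]
      exact Finset.sum_range_add _ _ _
  have hm0 : (0 : ℝ) < m := by positivity
  -- Convergence along multiples of `m` suffices: `f ≥ 0` makes the Birkhoff sums monotone, and
  -- consecutive multiples have ratio tending to `1`.
  refine tendsto_div_of_monotone_of_exists_subseq_tendsto_div _ _ ?_ fun a ha =>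
    ⟨fun n => n * m, ?_, ?_, ?_⟩
  · refine monotone_nat_of_le_succ fun n => ?_
    rw [birkhoffSum_succ]
    linarith [hf0 (shift^[n] V)]
  · obtain ⟨N, hN⟩ := exists_nat_gt (1 / (a - 1))
    filter_upwards [eventually_ge_atTop N] with n hn
    have hn' : (N : ℝ) ≤ n := by exact_mod_cast hn
    rw [div_lt_iff₀ (by linarith)] at hN
    push_cast
    have : (n : ℝ) + 1 ≤ a * n := by nlinarith
    calc ((n : ℝ) + 1) * m ≤ (a * n) * m := by gcongr
      _ = a * (n * m) := by ring
  · exact tendsto_id.atTop_mul_const' (show 0 < m by omega)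
  · have h1 : Tendsto (fun n : ℕ => (∑ r ∈ Finset.range m,
        (∑ i ∈ Finset.range n, f (shift^[i * m + r] V)) / n) / m) atTop
        (𝓝 ((∑ _r ∈ Finset.range m, ∫ V, f V ∂μ) / m)) :=
      (tendsto_finsetSum _ fun r _ => hV r).div_const _
    have e : (∑ _r ∈ Finset.range m, ∫ V, f V ∂μ) / m = ∫ V, f V ∂μ := by
      rw [Finset.sum_const, Finset.card_range, nsmul_eq_mul, mul_div_cancel_left₀ _ hm0.ne']
    rw [e] at h1
    refine h1.congr fun n => ?_
    rw [hblock, ← Finset.sum_div, div_div]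
    push_cast
    rfl

/-! ### Stationarity and locality of the crossing times -/

section Stationary

lemma hit_shift (α : ℤ → ℝ) (k z : ℤ) : hit (fun x => α (x + k)) z = hit α (z + k) := by
  have h : ∀ j : ℕ, z - j + k = z + k - j := fun j => by ring
  simp only [hit, h]

lemma ret_shift (α : ℤ → ℝ) (k z : ℤ) : ret (fun x => α (x + k)) z = ret α (z + k) := by
  unfold ret
  rw [hit_shift, hit_shift, show z - 1 + k = z + k - 1 by ring]

lemma crossTerm_shift (α : ℤ → ℝ) (k z : ℤ) (n : ℕ) :
    crossTerm (fun x => α (x + k)) z n = crossTerm α (z + k) n := by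
  unfold crossTerm
  simp only [ret_shift]
  have : ∀ j : ℕ, z - j + k = z + k - j := fun j => by ring
  simp only [this]

lemma rate_shift_iterate (k : ℕ) (V : ℤ → ℝ≥0) :
    rate (shift^[k] V) = fun x => rate V (x + k) := by
  rw [shift_iterate]
  rfl

lemma crossTerm_rate_shift_iterate (k : ℕ) (V : ℤ → ℝ≥0) (z : ℤ) (n : ℕ) :
    crossTerm (rate (shift^[k] V)) z n = crossTerm (rate V) (z + k) n := by
  rw [rate_shift_iterate, crossTerm_shift]

lemma crossTime_rate_shift_iterate (k : ℕ) (V : ℤ → ℝ≥0) :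
    crossTime (rate (shift^[k] V)) 0 = crossTime (rate V) k := by
  simp only [crossTime, crossTerm_rate_shift_iterate, zero_add]

lemma measurable_rate (x : ℤ) : Measurable fun V : ℤ → ℝ≥0 => rate V x := by
  unfold rate
  fun_prop

lemma measurable_contFrac_rate (n : ℕ) (g : ℕ → ℤ) :
    Measurable fun V : ℤ → ℝ≥0 => contFrac n (fun k => rate V (g k)) := by
  induction n generalizing g with
  | zero => exact measurable_const
  | succ n ih =>
    simp only [contFrac]
    exact (measurable_rate _).div
      (measurable_const.sub ((measurable_rate _).mul (ih fun k => g (k + 1))))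

lemma measurable_hit_rate (z : ℤ) : Measurable fun V : ℤ → ℝ≥0 => hit (rate V) z :=
  measurable_of_tendsto_metrizable (fun n => measurable_contFrac_rate n fun k => z - k)
    (tendsto_pi_nhds.2 fun V => tendsto_contFrac_hit (isRate_rate V) z)

lemma measurable_ret_rate (z : ℤ) : Measurable fun V : ℤ → ℝ≥0 => ret (rate V) z :=
  (measurable_hit_rate z).mul (measurable_hit_rate (z - 1))

lemma measurable_crossTerm_rate (z : ℤ) (k : ℕ) :
    Measurable fun V : ℤ → ℝ≥0 => crossTerm (rate V) z k :=
  (measurable_const.add (measurable_ret_rate _)).mul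
    (Finset.measurable_fun_prod _ fun _ _ => measurable_ret_rate _)

lemma measurable_crossTime_rate (z : ℤ) : Measurable fun V : ℤ → ℝ≥0 => crossTime (rate V) z :=
  Measurable.tsum fun k => (measurable_crossTerm_rate z k).ennreal_ofReal

/-! ### Local approximations of the crossing time -/

/-- The approximation of `ret` by finite continued fractions. -/
def retApprox (α : ℤ → ℝ) (n : ℕ) (z : ℤ) : ℝ :=
  contFrac n (fun k : ℕ => α (z - k)) * contFrac n (fun k : ℕ => α (z - 1 - k))

/-- The approximation of `crossTerm α 0` by finite continued fractions. -/
def crossTermApprox (α : ℤ → ℝ) (n k : ℕ) : ℝ :=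
  (1 + retApprox α n (-k)) * ∏ j ∈ Finset.range k, retApprox α n (-j)

/-- A local approximation of `crossTime α 0`. -/
def crossTimeApprox (α : ℤ → ℝ) (n : ℕ) : ℝ := ∑ k ∈ Finset.range n, crossTermApprox α n k

lemma retApprox_nonneg (hα : IsRate α) (n : ℕ) (z : ℤ) : 0 ≤ retApprox α n z :=
  mul_nonneg (contFrac_mem n (hα.comp _)).1 (contFrac_mem n (hα.comp _)).1

lemma retApprox_le_one (hα : IsRate α) (n : ℕ) (z : ℤ) : retApprox α n z ≤ 1 :=
  mul_le_one₀ (contFrac_mem n (hα.comp _)).2.le (contFrac_mem n (hα.comp _)).1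
    (contFrac_mem n (hα.comp _)).2.le

lemma retApprox_mono (hα : IsRate α) (z : ℤ) : Monotone fun n => retApprox α n z :=
  fun m n hmn => mul_le_mul (contFrac_mono (hα.comp _) hmn) (contFrac_mono (hα.comp _) hmn)
    (contFrac_mem m (hα.comp _)).1 (contFrac_mem n (hα.comp _)).1

lemma tendsto_retApprox (hα : IsRate α) (z : ℤ) :
    Tendsto (fun n => retApprox α n z) atTop (𝓝 (ret α z)) :=
  (tendsto_contFrac_hit hα z).mul (tendsto_contFrac_hit hα (z - 1))

lemma crossTermApprox_nonneg (hα : IsRate α) (n k : ℕ) : 0 ≤ crossTermApprox α n k :=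
  mul_nonneg (by linarith [retApprox_nonneg hα n (-k)])
    (Finset.prod_nonneg fun _ _ => retApprox_nonneg hα n _)

lemma crossTermApprox_mono (hα : IsRate α) (k : ℕ) : Monotone fun n => crossTermApprox α n k :=
  fun m n hmn => mul_le_mul (add_le_add le_rfl (retApprox_mono hα _ hmn))
    (Finset.prod_le_prod (fun _ _ => retApprox_nonneg hα m _) fun _ _ => retApprox_mono hα _ hmn)
    (Finset.prod_nonneg fun _ _ => retApprox_nonneg hα m _)
    (by linarith [retApprox_nonneg hα n (-k)])

lemma tendsto_crossTermApprox (hα : IsRate α) (k : ℕ) :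
    Tendsto (fun n => crossTermApprox α n k) atTop (𝓝 (crossTerm α 0 k)) := by
  simp only [crossTermApprox, crossTerm, zero_sub]
  exact (tendsto_const_nhds.add (tendsto_retApprox hα _)).mul
    (tendsto_finsetProd _ fun j _ => tendsto_retApprox hα _)

lemma crossTimeApprox_nonneg (hα : IsRate α) (n : ℕ) : 0 ≤ crossTimeApprox α n :=
  Finset.sum_nonneg fun k _ => crossTermApprox_nonneg hα n k

lemma crossTimeApprox_le (hα : IsRate α) (n : ℕ) : crossTimeApprox α n ≤ n * 2 := by
  have h : ∀ k ∈ Finset.range n, crossTermApprox α n k ≤ 2 := fun k _ => by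
    have h1 := retApprox_le_one hα n (-k)
    have h2 : ∏ j ∈ Finset.range k, retApprox α n (-j) ≤ 1 :=
      Finset.prod_le_one (fun _ _ => retApprox_nonneg hα n _) fun _ _ => retApprox_le_one hα n _
    have h3 : 0 ≤ ∏ j ∈ Finset.range k, retApprox α n (-j) :=
      Finset.prod_nonneg fun _ _ => retApprox_nonneg hα n _
    unfold crossTermApprox
    nlinarith [retApprox_nonneg hα n (-k)]
  simpa [crossTimeApprox] using Finset.sum_le_card_nsmul _ _ _ h

lemma crossTimeApprox_mono (hα : IsRate α) : Monotone (crossTimeApprox α) := fun _ n hmn =>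
  (Finset.sum_le_sum fun k _ => crossTermApprox_mono hα k hmn).trans
    (Finset.sum_le_sum_of_subset_of_nonneg (Finset.range_mono hmn)
      fun k _ _ => crossTermApprox_nonneg hα n k)

lemma crossTime_eq_iSup_approx (hα : IsRate α) :
    crossTime α 0 = ⨆ n, ENNReal.ofReal (crossTimeApprox α n) := by
  rw [crossTime_eq_iSup hα]
  refine le_antisymm (iSup_le fun K => ?_) (iSup_le fun n => ?_)
  · refine le_of_tendsto (ENNReal.tendsto_ofReal
      (tendsto_finsetSum (Finset.range K) fun k _ => tendsto_crossTermApprox hα k)) ?_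
    filter_upwards [eventually_ge_atTop K] with n hn
    refine le_trans (ENNReal.ofReal_le_ofReal ?_)
      (le_iSup (fun n => ENNReal.ofReal (crossTimeApprox α n)) n)
    exact Finset.sum_le_sum_of_subset_of_nonneg (Finset.range_mono hn)
      fun k _ _ => crossTermApprox_nonneg hα n k
  · refine le_trans (ENNReal.ofReal_le_ofReal ?_)
      (le_iSup (fun n => ENNReal.ofReal (∑ k ∈ Finset.range n, crossTerm α 0 k)) n)
    exact Finset.sum_le_sum fun k _ =>
      (crossTermApprox_mono hα k).ge_of_tendsto (tendsto_crossTermApprox hα k) n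

lemma tendsto_crossTimeApprox (hα : IsRate α) :
    Tendsto (fun n => ENNReal.ofReal (crossTimeApprox α n)) atTop (𝓝 (crossTime α 0)) := by
  rw [crossTime_eq_iSup_approx hα]
  exact tendsto_atTop_iSup fun m n hmn => ENNReal.ofReal_le_ofReal (crossTimeApprox_mono hα hmn)

lemma measurable_crossTimeApprox_rate (n : ℕ) :
    Measurable fun V : ℤ → ℝ≥0 => crossTimeApprox (rate V) n := by
  have hret : ∀ z, Measurable fun V : ℤ → ℝ≥0 => retApprox (rate V) n z := fun z =>
    (measurable_contFrac_rate n fun k => z - k).mul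
      (measurable_contFrac_rate n fun k => z - 1 - k)
  exact Finset.measurable_fun_sum _ fun k _ => (measurable_const.add (hret _)).mul
    (Finset.measurable_fun_prod _ fun _ _ => hret _)

lemma contFrac_congr (n : ℕ) {β β' : ℕ → ℝ} (h : ∀ k < n, β k = β' k) :
    contFrac n β = contFrac n β' := by
  induction n generalizing β β' with
  | zero => rfl
  | succ n ih =>
    rw [contFrac, contFrac, h 0 (by omega), ih fun k hk => h (k + 1) (by omega)]

/-- The leftmost site read is `-(n - 1) - 1 - (n - 1)`, from the last site of the series and the
deepest level of the shifted fraction; hence a window of length `2 * n`. -/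
lemma crossTimeApprox_congr (n : ℕ) {α' : ℤ → ℝ}
    (h : ∀ x, -((2 * n : ℕ) : ℤ) ≤ x → x ≤ 0 → α x = α' x) :
    crossTimeApprox α n = crossTimeApprox α' n := by
  have hret : ∀ j : ℕ, j < n → retApprox α n (-j) = retApprox α' n (-j) := by
    intro j hj
    unfold retApprox
    rw [contFrac_congr n fun k hk => h (-j - k) (by push_cast; omega) (by omega),
      contFrac_congr n fun k hk => h (-j - 1 - k) (by push_cast; omega) (by omega)]
  refine Finset.sum_congr rfl fun k hk => ?_
  have hk' := Finset.mem_range.1 hk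
  unfold crossTermApprox
  rw [hret k hk', Finset.prod_congr rfl fun j hj =>
    hret j ((Finset.mem_range.1 hj).trans hk')]

/-- The mean crossing times per unit length converge almost surely. -/
lemma ae_tendsto_meanCrossingTime (ν : Measure ℝ≥0) [IsProbabilityMeasure ν]
    (hfin : ∫⁻ V, crossTime (rate V) 0 ∂(Measure.infinitePi fun _ : ℤ => ν) ≠ ∞) :
    ∀ᵐ V ∂(Measure.infinitePi fun _ : ℤ => ν),
      Tendsto (fun y : ℕ => meanCrossingTime V y / (y : ℝ≥0∞)) atTop
        (𝓝 (∫⁻ V, crossTime (rate V) 0 ∂(Measure.infinitePi fun _ : ℤ => ν))) := by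
  set μ := Measure.infinitePi fun _ : ℤ => ν
  have hθ := measurePreserving_shift ν
  have hm := measurable_crossTime_rate 0
  set F : (ℤ → ℝ≥0) → ℝ := fun V => (crossTime (rate V) 0).toReal
  have hFi : Integrable F μ := integrable_toReal_of_lintegral_ne_top hm.aemeasurable hfin
  have hae : ∀ᵐ V ∂μ, crossTime (rate V) 0 < ∞ := ae_lt_top hm hfin
  have hFint : ∫ V, F V ∂μ = (∫⁻ V, crossTime (rate V) 0 ∂μ).toReal :=
    integral_toReal hm.aemeasurable hae
  have hai : ∀ n, Integrable (fun V => crossTimeApprox (rate V) n) μ := fun n =>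
    Integrable.of_bound (measurable_crossTimeApprox_rate n).aestronglyMeasurable (n * 2)
      (Eventually.of_forall fun V => by
        rw [Real.norm_of_nonneg (crossTimeApprox_nonneg (isRate_rate V) n)]
        exact crossTimeApprox_le (isRate_rate V) n)
  have hle : ∀ n, (fun V => crossTimeApprox (rate V) n) ≤ᵐ[μ] F := by
    intro n
    filter_upwards [hae] with V hV
    refine (ENNReal.ofReal_le_iff_le_toReal hV.ne).1 ?_
    rw [crossTime_eq_iSup_approx (isRate_rate V)]
    exact le_iSup (fun n => ENNReal.ofReal (crossTimeApprox (rate V) n)) n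
  have hlim : Tendsto (fun n => ∫ V, crossTimeApprox (rate V) n ∂μ) atTop (𝓝 (∫ V, F V ∂μ)) := by
    have h := lintegral_tendsto_of_tendsto_of_monotone (μ := μ)
      (f := fun n V => ENNReal.ofReal (crossTimeApprox (rate V) n))
      (F := fun V => crossTime (rate V) 0)
      (fun n => (measurable_crossTimeApprox_rate n).ennreal_ofReal.aemeasurable)
      (Eventually.of_forall fun V m n hmn =>
        ENNReal.ofReal_le_ofReal (crossTimeApprox_mono (isRate_rate V) hmn))
      (Eventually.of_forall fun V => tendsto_crossTimeApprox (isRate_rate V))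
    rw [hFint]
    refine ((ENNReal.tendsto_toReal hfin).comp h).congr fun n => ?_
    exact (integral_eq_lintegral_of_nonneg_ae
      (Eventually.of_forall fun V => crossTimeApprox_nonneg (isRate_rate V) n)
      (measurable_crossTimeApprox_rate n).aestronglyMeasurable).symm
  have hconv := ae_tendsto_birkhoffSum_of_approx hθ hm.ennreal_toReal hFi
    measurable_crossTimeApprox_rate hai hle hlim fun n =>
      ae_tendsto_birkhoffSum_shift_of_local (measurable_crossTimeApprox_rate n)
        (fun V => crossTimeApprox_nonneg (isRate_rate V) n) (hai n) (w := 2 * n)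
        fun V V' h => crossTimeApprox_congr n fun x h1 h2 => by rw [rate, rate, h x h1 h2]
  have hfin' : ∀ᵐ V ∂μ, ∀ k : ℕ, crossTime (rate (shift^[k] V)) 0 < ∞ :=
    ae_all_iff.2 fun k => (hθ.iterate k).quasiMeasurePreserving.ae hae
  filter_upwards [hconv, hfin'] with V hV hVfin
  have h := ENNReal.tendsto_ofReal hV
  rw [hFint, ENNReal.ofReal_toReal hfin] at h
  refine h.congr' ?_
  filter_upwards [eventually_gt_atTop 0] with y hy
  have hy' : (0 : ℝ) < y := by exact_mod_cast hy
  rw [ENNReal.ofReal_div_of_pos hy', ENNReal.ofReal_natCast, meanCrossingTime_eq_sum V hy.ne',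
    birkhoffSum, ENNReal.ofReal_sum_of_nonneg fun _ _ => ENNReal.toReal_nonneg]
  congr 1
  refine Finset.sum_congr rfl fun k _ => ?_
  rw [ENNReal.ofReal_toReal (hVfin k).ne, crossTime_rate_shift_iterate]

/-! ### The mean crossing time through the Green function -/

/-- The Green function at `0` of the walk killed at distance `K` to the right. -/
def green (α : ℤ → ℝ) (K : ℕ) : ℝ :=
  1 / (1 - α 0 * (hit α (-1) + contFrac K (fun k : ℕ => α (1 + k))))

/-- After the leading `1`, a factor `ret α (z + 1)` leaves the same sum based at `z + 1`. The right
side obeys this recursion too: unfold `hit` at `z + 1` and the outer level of the right-hand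
fraction, and both denominators reduce to `1 - a * R - a * H`. -/
lemma sum_prod_ret (hα : IsRate α) (K : ℕ) (z : ℤ) :
    ∑ k ∈ Finset.range (K + 1), ∏ j ∈ Finset.range k, ret α (z + 1 + j) =
      1 / (1 - hit α z * contFrac K (fun k : ℕ => α (z + 1 + k))) := by
  induction K generalizing z with
  | zero => simp [contFrac]
  | succ K ih =>
    have hR := contFrac_mem K (hα.comp fun k : ℕ => z + 1 + 1 + (k : ℤ))
    have h := ih (z + 1)
    rw [Finset.sum_range_succ']
    simp only [Finset.prod_range_succ', Finset.prod_range_zero, Nat.cast_zero, add_zero]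
    have e : ∀ j : ℕ, z + 1 + ((j + 1 : ℕ) : ℤ) = z + 1 + 1 + j := fun j => by push_cast; ring
    simp only [e]
    rw [← Finset.sum_mul, h, contFrac_succ_right, ret, add_sub_cancel_right, hit_eq hα (z + 1),
      add_sub_cancel_right]
    set R := contFrac K fun k : ℕ => α (z + 1 + 1 + k)
    set H := hit α z
    set a := α (z + 1)
    have hH := hit_le_one hα z
    have ha := hα (z + 1)
    have d1 : 0 < 1 - a * H := one_sub_rate_mul_pos ha.1 ha.2 hH
    have d2 : 0 < 1 - a * R := one_sub_rate_mul_pos ha.1 ha.2 hR.2.le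
    have d3 : 0 < 1 - a * R - a * H := by
      have : a * (R + H) < 1 := by nlinarith [ha.1, ha.2, hR.2, hR.1, hit_pos hα z]
      linarith
    have e1 : 1 - a / (1 - a * H) * R = (1 - a * R - a * H) / (1 - a * H) := by
      field_simp; ring
    have e2 : 1 - H * (a / (1 - a * R)) = (1 - a * R - a * H) / (1 - a * R) := by
      field_simp
    rw [e1, e2]
    field_simp
    ring

lemma one_sub_green_denom_pos (hα : IsRate α) (K : ℕ) :
    0 < 1 - α 0 * (hit α (-1) + contFrac K (fun k : ℕ => α (1 + k))) := by
  have hR := contFrac_mem K (hα.comp fun k : ℕ => 1 + (k : ℤ))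
  nlinarith [(hα 0).1, (hα 0).2, hR.2, hR.1, hit_pos hα (-1), hit_le_one hα (-1)]

lemma sum_one_add_ret_mul_prod (hα : IsRate α) (K : ℕ) :
    ∑ k ∈ Finset.range (K + 1), (1 + ret α 0) * ∏ j ∈ Finset.range k, ret α (1 + j) =
      green α K := by
  have h := sum_prod_ret hα K 0
  rw [zero_add] at h
  have hR := contFrac_mem K (hα.comp fun k : ℕ => 1 + (k : ℤ))
  have hd := one_sub_green_denom_pos hα K
  rw [← Finset.mul_sum, h, one_add_ret hα, hit_eq hα 0, green, zero_sub]
  set R := contFrac K fun k : ℕ => α (1 + k)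
  have d1 : 0 < 1 - α 0 * hit α (-1) := one_sub_mul_hit_pos hα 0 (-1)
  have e1 : 1 - α 0 / (1 - α 0 * hit α (-1)) * R =
      (1 - α 0 * (hit α (-1) + R)) / (1 - α 0 * hit α (-1)) := by
    field_simp; ring
  rw [e1]
  field_simp

/-- The Green function at `0` of the walk on the whole line. -/
def greenSum (α : ℤ → ℝ) : ℝ≥0∞ :=
  ∑' k : ℕ, ENNReal.ofReal ((1 + ret α 0) * ∏ j ∈ Finset.range k, ret α (1 + j))

lemma greenSum_eq_iSup (hα : IsRate α) : greenSum α = ⨆ K, ENNReal.ofReal (green α K) := by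
  have h0 : ∀ k : ℕ, 0 ≤ (1 + ret α 0) * ∏ j ∈ Finset.range k, ret α (1 + j) := fun k =>
    mul_nonneg (by linarith [ret_pos hα 0]) (Finset.prod_nonneg fun _ _ => (ret_pos hα _).le)
  rw [greenSum, ENNReal.tsum_eq_iSup_nat' (tendsto_add_atTop_nat 1)]
  congr 1
  ext K
  rw [← sum_one_add_ret_mul_prod hα, ENNReal.ofReal_sum_of_nonneg fun k _ => h0 k]

/-- Mass transport: exchange sum and expectation, then shift the `k`-th term by `k`. Visits to `-k`
while crossing from `0` become visits to `0` while crossing from `k`. -/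
lemma lintegral_crossTime_eq (ν : Measure ℝ≥0) [IsProbabilityMeasure ν] :
    ∫⁻ V, crossTime (rate V) 0 ∂(Measure.infinitePi fun _ : ℤ => ν) =
      ∫⁻ V, greenSum (rate V) ∂(Measure.infinitePi fun _ : ℤ => ν) := by
  have hθ := measurePreserving_shift ν
  have hg : ∀ k : ℕ, Measurable fun V : ℤ → ℝ≥0 =>
      (1 + ret (rate V) 0) * ∏ j ∈ Finset.range k, ret (rate V) (1 + j) := fun k =>
    (measurable_const.add (measurable_ret_rate _)).mul
      (Finset.measurable_fun_prod _ fun _ _ => measurable_ret_rate _)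
  simp only [crossTime, greenSum]
  rw [lintegral_tsum fun k => (measurable_crossTerm_rate 0 k).ennreal_ofReal.aemeasurable,
    lintegral_tsum fun k => (hg k).ennreal_ofReal.aemeasurable]
  refine tsum_congr fun k => ?_
  rw [← (hθ.iterate k).lintegral_comp (measurable_crossTerm_rate 0 k).ennreal_ofReal]
  refine lintegral_congr fun V => ?_
  rw [crossTerm_rate_shift_iterate, crossTerm, ← Finset.prod_range_reflect, zero_add, sub_self]
  congr 2
  refine Finset.prod_congr rfl fun j hj => ?_
  have := Finset.mem_range.1 hj
  congr 1
  omega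

end Stationary

/-! ### Bounds on the Green function between two obstacles -/

section Bounds

/-- In the coordinate `1 - 1/s` of the two return probabilities, the Green function at a free site
is the harmonic mean of `s` and `t`. -/
lemma one_div_one_sub_half_le {s t x y : ℝ} (hs : 0 < s) (ht : 0 < t) (hx : x ≤ 1 - 1 / s)
    (hy : y ≤ 1 - 1 / t) : 1 / (1 - 1 / 2 * (x + y)) ≤ 2 * s * t / (s + t) := by
  have e : 2 * s * t / (s + t) = 1 / ((1 / s + 1 / t) / 2) := by field_simp; ring
  rw [e]
  refine one_div_le_one_div_of_le (by positivity) ?_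
  linarith

lemma le_one_div_one_sub_half {s t x y : ℝ} (hs : 0 < s) (ht : 0 < t) (hx : 1 - 1 / s ≤ x)
    (hy : 1 - 1 / t ≤ y) (hd : 0 < 1 - 1 / 2 * (x + y)) :
    2 * s * t / (s + t) ≤ 1 / (1 - 1 / 2 * (x + y)) := by
  have e : 2 * s * t / (s + t) = 1 / ((1 / s + 1 / t) / 2) := by field_simp; ring
  rw [e]
  refine one_div_le_one_div_of_le hd ?_
  linarith

/-- The partial derivatives of `2st/(s+t)` sum to `2(s² + t²)/(s+t)² ≤ 2`. The softness error is
therefore bounded uniformly in the gap lengths. -/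
lemma harmonicMean_add_le {s t δ : ℝ} (hs : 0 < s) (ht : 0 < t) (hδ : 0 ≤ δ) :
    2 * (s + δ) * (t + δ) / (s + δ + (t + δ)) ≤ 2 * s * t / (s + t) + 2 * δ := by
  have e : 2 * s * t / (s + t) + 2 * δ = (2 * s * t + 2 * δ * (s + t)) / (s + t) := by
    field_simp
  rw [e, div_le_div_iff₀ (by positivity) (by positivity)]
  nlinarith [mul_nonneg hδ (mul_nonneg hs.le ht.le), mul_nonneg hδ hδ, mul_nonneg hδ hs.le,
    mul_nonneg hδ ht.le, mul_nonneg (mul_nonneg hδ hδ) (add_nonneg hs.le ht.le),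
    mul_nonneg (mul_nonneg hδ hs.le) ht.le]

lemma greenSum_le_of_run (hα : IsRate α) {a : ℝ} (ha : 0 < a) (ha1 : a < 1) {i j : ℕ}
    (h0 : α 0 = 1 / 2) (hl : ∀ k : ℕ, k < i → α (-1 - k) = 1 / 2) (hli : α (-1 - i) = a / 2)
    (hr : ∀ k : ℕ, k < j → α (1 + k) = 1 / 2) (hrj : α (1 + j) = a / 2) :
    greenSum α ≤ ENNReal.ofReal
      (2 * ((i : ℝ) + 1) * ((j : ℝ) + 1) / ((i : ℝ) + 1 + ((j : ℝ) + 1)) + a / (1 - a)) := by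
  rw [greenSum_eq_iSup hα]
  refine iSup_le fun K => ENNReal.ofReal_le_ofReal ?_
  set δ := a / (2 * (1 - a)) with hδ
  have hδ0 : 0 ≤ δ := div_nonneg ha.le (by linarith)
  have hL : hit α (-1) ≤ 1 - 1 / ((i : ℝ) + 1 + δ) :=
    ciSup_le fun n => contFrac_le_of_run n ha ha1 (hα.comp fun k : ℕ => -1 - (k : ℤ)) hl hli
  have hR := contFrac_le_of_run K ha ha1 (hα.comp fun k : ℕ => 1 + (k : ℤ)) hr hrj
  have e : a / (1 - a) = 2 * δ := by
    have : 1 - a ≠ 0 := by linarith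
    rw [hδ]; field_simp
  rw [green, h0, e]
  exact (one_div_one_sub_half_le (by positivity) (by positivity) hL hR).trans
    (harmonicMean_add_le (by positivity) (by positivity) hδ0)

/-- Only excursions inside the free stretch are counted, as if everything beyond it were lethal; no
information on the obstacles is needed. -/
lemma le_greenSum_of_run (hα : IsRate α) {i j : ℕ}
    (h0 : α 0 = 1 / 2) (hl : ∀ k : ℕ, k < i → α (-1 - k) = 1 / 2)
    (hr : ∀ k : ℕ, k < j → α (1 + k) = 1 / 2) :
    ENNReal.ofReal (2 * ((i : ℝ) + 1) * ((j : ℝ) + 1) / ((i : ℝ) + 1 + ((j : ℝ) + 1))) ≤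
      greenSum α := by
  rw [greenSum_eq_iSup hα]
  refine le_trans (ENNReal.ofReal_le_ofReal ?_) (le_iSup (fun K => ENNReal.ofReal (green α K)) j)
  have hL : 1 - 1 / ((i : ℝ) + 1) ≤ hit α (-1) :=
    (le_contFrac_of_run (hα.comp fun k : ℕ => -1 - (k : ℤ)) hl le_rfl).trans
      (contFrac_le_lim i (hα.comp fun k : ℕ => -1 - (k : ℤ)))
  have hR := le_contFrac_of_run (hα.comp fun k : ℕ => 1 + (k : ℤ)) hr le_rfl
  have hd := one_sub_green_denom_pos hα j
  rw [h0] at hd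
  rw [green, h0]
  exact le_one_div_one_sub_half (by positivity) (by positivity) hL hR hd

lemma one_le_greenSum (hα : IsRate α) : 1 ≤ greenSum α := by
  rw [greenSum_eq_iSup hα]
  refine le_trans ?_ (le_iSup (fun K => ENNReal.ofReal (green α K)) 0)
  rw [← ENNReal.ofReal_one]
  refine ENNReal.ofReal_le_ofReal ?_
  have hd := one_sub_green_denom_pos hα 0
  rw [green, le_div_iff₀ hd]
  have h1 := mul_pos (hα 0).1 (hit_pos hα (-1))
  simp only [contFrac]
  linarith

/-- Each visit to `0` is survived with probability `a`, so the number of visits is dominated by a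
geometric variable of mean `1 / (1 - a)`. -/
lemma greenSum_le_of_obstacle (hα : IsRate α) {a : ℝ} (ha : 0 < a) (ha1 : a < 1)
    (h0 : α 0 = a / 2) : greenSum α ≤ ENNReal.ofReal (1 / (1 - a)) := by
  rw [greenSum_eq_iSup hα]
  refine iSup_le fun K => ENNReal.ofReal_le_ofReal ?_
  have hR := contFrac_mem K (hα.comp fun k : ℕ => 1 + (k : ℤ))
  have hL := hit_le_one hα (-1)
  rw [green, h0]
  refine one_div_le_one_div_of_le (by linarith) ?_
  nlinarith

end Bounds

/-! ### Sums over pairs of geometric variables -/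

lemma tsum_prod_antidiagonal (f : ℕ × ℕ → ℝ≥0∞) :
    ∑' q : ℕ × ℕ, f q = ∑' n : ℕ, ∑ q ∈ Finset.HasAntidiagonal.antidiagonal n, f q := by
  rw [← Finset.HasAntidiagonal.sigmaAntidiagonalEquivProd.tsum_eq, ENNReal.tsum_sigma']
  refine tsum_congr fun n => ?_
  exact Finset.tsum_subtype (Finset.HasAntidiagonal.antidiagonal n) f

lemma sum_range_mul_sub (c : ℝ) (m : ℕ) :
    ∑ k ∈ Finset.range m, ((k : ℝ) + 1) * (c - k) =
      c * m * (m + 1) / 2 - ((m : ℝ) - 1) * m * (m + 1) / 3 := by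
  induction m with
  | zero => simp
  | succ m ih => rw [Finset.sum_range_succ, ih]; push_cast; ring

/-- On the antidiagonal the denominator is the constant `n + 2`, so the sum is polynomial apart from
this factor, which cancels. -/
lemma sum_antidiagonal_harmonicMean (n : ℕ) :
    ∑ q ∈ Finset.HasAntidiagonal.antidiagonal n,
      2 * ((q.1 : ℝ) + 1) * ((q.2 : ℝ) + 1) / ((q.1 : ℝ) + 1 + ((q.2 : ℝ) + 1)) =
      ((n : ℝ) + 1) * (n + 3) / 3 := by
  have h : ∀ q ∈ Finset.HasAntidiagonal.antidiagonal n,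
      2 * ((q.1 : ℝ) + 1) * ((q.2 : ℝ) + 1) / ((q.1 : ℝ) + 1 + ((q.2 : ℝ) + 1)) =
        2 / ((n : ℝ) + 2) * (((q.1 : ℝ) + 1) * ((n : ℝ) + 1 - q.1)) := by
    intro q hq
    have hq' : (q.1 : ℝ) + q.2 = n := by exact_mod_cast Finset.HasAntidiagonal.mem_antidiagonal.1 hq
    rw [← hq']
    have : (q.1 : ℝ) + 1 + (q.2 + 1) ≠ 0 := by positivity
    have : (q.1 : ℝ) + q.2 + 2 ≠ 0 := by positivity
    field_simp
    ring
  rw [Finset.sum_congr rfl h, ← Finset.mul_sum,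
    Finset.Nat.sum_antidiagonal_eq_sum_range_succ
      (fun i _ => ((i : ℝ) + 1) * ((n : ℝ) + 1 - i)), sum_range_mul_sub]
  have : (n : ℝ) + 2 ≠ 0 := by positivity
  push_cast
  field_simp
  ring

/-- The probability that the sites next to `0` are free, up to obstacles at the distances
`q.1 + 1` and `q.2 + 1`. -/
def gapWeight (p : ℝ) (q : ℕ × ℕ) : ℝ := p ^ 2 * (1 - p) ^ (q.1 + q.2 + 1)

lemma gapWeight_nonneg {p : ℝ} (hp1 : p ≤ 1) (q : ℕ × ℕ) : 0 ≤ gapWeight p q :=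
  mul_nonneg (sq_nonneg p) (pow_nonneg (by linarith) _)

lemma tsum_gapWeight {p : ℝ} (hp : 0 < p) (hp1 : p ≤ 1) :
    ∑' q : ℕ × ℕ, ENNReal.ofReal (gapWeight p q) = ENNReal.ofReal (1 - p) := by
  have hr : ‖1 - p‖ < 1 := by rw [Real.norm_of_nonneg (by linarith)]; linarith
  have hsum : HasSum (fun n : ℕ => p ^ 2 * (1 - p) * (((n + 1).choose 1 : ℕ) * (1 - p) ^ n))
      (1 - p) := by
    have h := (hasSum_choose_mul_geometric_of_norm_lt_one 1 hr).mul_left (p ^ 2 * (1 - p))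
    convert! h using 1
    rw [sub_sub_cancel]
    field_simp
    ring
  have hnn : ∀ n : ℕ, 0 ≤ p ^ 2 * (1 - p) * (((n + 1).choose 1 : ℕ) * (1 - p) ^ n) := fun n =>
    mul_nonneg (mul_nonneg (sq_nonneg p) (by linarith))
      (mul_nonneg (Nat.cast_nonneg _) (pow_nonneg (by linarith) n))
  rw [tsum_prod_antidiagonal, ← hsum.tsum_eq, ENNReal.ofReal_tsum_of_nonneg hnn hsum.summable]
  refine tsum_congr fun n => ?_
  rw [← ENNReal.ofReal_sum_of_nonneg fun q _ => gapWeight_nonneg hp1 q]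
  congr 1
  have h : ∀ q ∈ Finset.HasAntidiagonal.antidiagonal n, gapWeight p q =
      p ^ 2 * (1 - p) ^ (n + 1) := fun q hq => by
    rw [gapWeight, Finset.HasAntidiagonal.mem_antidiagonal.1 hq]
  rw [Finset.sum_congr rfl h, Finset.sum_const, Finset.Nat.card_antidiagonal, nsmul_eq_mul,
    Nat.choose_one_right]
  ring

lemma tsum_harmonicMean_gapWeight {p : ℝ} (hp : 0 < p) (hp1 : p ≤ 1) :
    ∑' q : ℕ × ℕ, ENNReal.ofReal
      (2 * ((q.1 : ℝ) + 1) * ((q.2 : ℝ) + 1) / ((q.1 : ℝ) + 1 + ((q.2 : ℝ) + 1))) *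
        ENNReal.ofReal (gapWeight p q) =
      ENNReal.ofReal ((1 - p) * (2 + p) / (3 * p)) := by
  have hr : ‖1 - p‖ < 1 := by rw [Real.norm_of_nonneg (by linarith)]; linarith
  -- Uses `(n + 1)(n + 3) = 2 * C(n + 2, 2) + C(n + 1, 1)`, which reduces the average over gaps to
  -- two negative binomial series.
  have hsum : HasSum (fun n : ℕ => p ^ 2 * (1 - p) / 3 *
      (2 * (((n + 2).choose 2 : ℕ) * (1 - p) ^ n) + ((n + 1).choose 1 : ℕ) * (1 - p) ^ n))
      ((1 - p) * (2 + p) / (3 * p)) := by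
    have h := (((hasSum_choose_mul_geometric_of_norm_lt_one 2 hr).mul_left 2).add
      (hasSum_choose_mul_geometric_of_norm_lt_one 1 hr)).mul_left (p ^ 2 * (1 - p) / 3)
    convert! h using 1
    rw [sub_sub_cancel]
    field_simp
    ring
  have hnn : ∀ n : ℕ, 0 ≤ p ^ 2 * (1 - p) / 3 *
      (2 * (((n + 2).choose 2 : ℕ) * (1 - p) ^ n) + ((n + 1).choose 1 : ℕ) * (1 - p) ^ n) :=
    fun n => by
      have : 0 ≤ 1 - p := by linarith
      positivity
  have hH : ∀ q : ℕ × ℕ,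
      0 ≤ 2 * ((q.1 : ℝ) + 1) * ((q.2 : ℝ) + 1) / ((q.1 : ℝ) + 1 + ((q.2 : ℝ) + 1)) :=
    fun q => by positivity
  rw [tsum_prod_antidiagonal, ← hsum.tsum_eq, ENNReal.ofReal_tsum_of_nonneg hnn hsum.summable]
  refine tsum_congr fun n => ?_
  simp only [← ENNReal.ofReal_mul (hH _)]
  rw [← ENNReal.ofReal_sum_of_nonneg fun q _ => mul_nonneg (hH q) (gapWeight_nonneg hp1 q)]
  congr 1
  have h : ∀ q ∈ Finset.HasAntidiagonal.antidiagonal n, gapWeight p q =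
      p ^ 2 * (1 - p) ^ (n + 1) := fun q hq => by
    rw [gapWeight, Finset.HasAntidiagonal.mem_antidiagonal.1 hq]
  rw [Finset.sum_congr rfl fun q hq => congrArg _ (h q hq), ← Finset.sum_mul,
    sum_antidiagonal_harmonicMean, Nat.choose_one_right, Nat.cast_choose_two]
  push_cast
  ring

/-! ### The Bernoulli potential -/

/-- The law of a single site of the Bernoulli potential. -/
def siteLaw (p : ℝ) (m : ℝ≥0) : Measure ℝ≥0 :=
  ENNReal.ofReal p • Measure.dirac m + ENNReal.ofReal (1 - p) • Measure.dirac 0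

lemma isProbabilityMeasure_siteLaw {p : ℝ} (hp : 0 < p) (hp1 : p ≤ 1) (m : ℝ≥0) :
    IsProbabilityMeasure (siteLaw p m) := by
  constructor
  simp only [siteLaw, Measure.add_apply, Measure.smul_apply, measure_univ, smul_eq_mul, mul_one]
  rw [← ENNReal.ofReal_add hp.le (by linarith)]
  simp

lemma siteLaw_obstacle (p : ℝ) {m : ℝ≥0} (hm : m ≠ 0) : siteLaw p m {m} = ENNReal.ofReal p := by
  simp [siteLaw, hm.symm]

lemma siteLaw_free (p : ℝ) {m : ℝ≥0} (hm : m ≠ 0) :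
    siteLaw p m {0} = ENNReal.ofReal (1 - p) := by
  simp [siteLaw, hm]

/-- The law of the Bernoulli potential. -/
def fieldLaw (p : ℝ) (m : ℝ≥0) : Measure (ℤ → ℝ≥0) := Measure.infinitePi fun _ : ℤ => siteLaw p m

/-- The admissible values at `x` when the obstacles nearest to `0` are at `-(q.1 + 1)` and
`q.2 + 1`. -/
def gapValue (m : ℝ≥0) (q : ℕ × ℕ) (x : ℤ) : Set ℝ≥0 :=
  if x = -1 - (q.1 : ℤ) ∨ x = 1 + (q.2 : ℤ) then {m} else {0}

/-- The event that the obstacles nearest to `0` are at `-(q.1 + 1)` and `q.2 + 1`, and that there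
is none at `0`. -/
def gapEvent (m : ℝ≥0) (q : ℕ × ℕ) : Set (ℤ → ℝ≥0) :=
  Set.pi (Finset.Icc (-1 - (q.1 : ℤ)) (1 + (q.2 : ℤ))) (gapValue m q)

lemma measurableSet_gapValue (m : ℝ≥0) (q : ℕ × ℕ) (x : ℤ) : MeasurableSet (gapValue m q x) := by
  unfold gapValue
  split_ifs <;> exact measurableSet_singleton _

lemma measurableSet_gapEvent (m : ℝ≥0) (q : ℕ × ℕ) : MeasurableSet (gapEvent m q) :=
  MeasurableSet.pi (Finset.countable_toSet _) fun x _ => measurableSet_gapValue m q x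

section

variable {m : ℝ≥0} {q : ℕ × ℕ} {V : ℤ → ℝ≥0}

lemma apply_left_of_mem_gapEvent (h : V ∈ gapEvent m q) : V (-1 - (q.1 : ℤ)) = m := by
  have := h (-1 - (q.1 : ℤ)) (by simp; omega)
  simpa [gapValue] using this

lemma apply_right_of_mem_gapEvent (h : V ∈ gapEvent m q) : V (1 + (q.2 : ℤ)) = m := by
  have := h (1 + (q.2 : ℤ)) (by simp; omega)
  simpa [gapValue] using this

lemma apply_of_mem_gapEvent (h : V ∈ gapEvent m q) {x : ℤ} (h1 : -1 - (q.1 : ℤ) < x)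
    (h2 : x < 1 + (q.2 : ℤ)) : V x = 0 := by
  have := h x (by simp; omega)
  rw [gapValue, if_neg (by omega)] at this
  simpa using this

lemma pairwise_disjoint_gapEvent (hm : m ≠ 0) :
    Pairwise (Function.onFun Disjoint (gapEvent m)) := by
  intro q q' hqq
  refine Set.disjoint_left.2 fun V h h' => hqq ?_
  have e1 : q.1 = q'.1 := by
    rcases lt_trichotomy q.1 q'.1 with hlt | heq | hlt
    · exact absurd ((apply_left_of_mem_gapEvent h).symm.trans
        (apply_of_mem_gapEvent h' (by omega) (by omega))) hm
    · exact heq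
    · exact absurd ((apply_left_of_mem_gapEvent h').symm.trans
        (apply_of_mem_gapEvent h (by omega) (by omega))) hm
  have e2 : q.2 = q'.2 := by
    rcases lt_trichotomy q.2 q'.2 with hlt | heq | hlt
    · exact absurd ((apply_right_of_mem_gapEvent h).symm.trans
        (apply_of_mem_gapEvent h' (by omega) (by omega))) hm
    · exact heq
    · exact absurd ((apply_right_of_mem_gapEvent h').symm.trans
        (apply_of_mem_gapEvent h (by omega) (by omega))) hm
  exact Prod.ext e1 e2

end

lemma fieldLaw_gapEvent {p : ℝ} (hp : 0 < p) (hp1 : p ≤ 1) {m : ℝ≥0} (hm : m ≠ 0) (q : ℕ × ℕ) :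
    fieldLaw p m (gapEvent m q) = ENNReal.ofReal (gapWeight p q) := by
  have := isProbabilityMeasure_siteLaw hp hp1 m
  have hval : ∀ x, siteLaw p m (gapValue m q x) =
      if x = -1 - (q.1 : ℤ) ∨ x = 1 + (q.2 : ℤ) then ENNReal.ofReal p
        else ENNReal.ofReal (1 - p) := by
    intro x
    unfold gapValue
    split_ifs
    · exact siteLaw_obstacle p hm
    · exact siteLaw_free p hm
  have h1 : (Finset.Icc (-1 - (q.1 : ℤ)) (1 + (q.2 : ℤ))).filter
      (fun x => x = -1 - (q.1 : ℤ) ∨ x = 1 + (q.2 : ℤ)) = {-1 - (q.1 : ℤ), 1 + (q.2 : ℤ)} := by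
    ext x
    simp only [Finset.mem_filter, Finset.mem_Icc, Finset.mem_insert, Finset.mem_singleton]
    omega
  have h2 : (Finset.Icc (-1 - (q.1 : ℤ)) (1 + (q.2 : ℤ))).filter
      (fun x => ¬ (x = -1 - (q.1 : ℤ) ∨ x = 1 + (q.2 : ℤ))) =
      Finset.Icc (-(q.1 : ℤ)) (q.2 : ℤ) := by
    ext x
    simp only [Finset.mem_filter, Finset.mem_Icc]
    omega
  have h3 : (Finset.Icc (-(q.1 : ℤ)) (q.2 : ℤ)).card = q.1 + q.2 + 1 := by
    rw [Int.card_Icc]; omega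
  rw [fieldLaw, gapEvent, Measure.infinitePi_pi _ fun x _ => measurableSet_gapValue m q x,
    Finset.prod_congr rfl fun x _ => hval x, Finset.prod_ite, h1, h2, Finset.prod_const,
    Finset.prod_const, h3, Finset.card_pair (by omega), gapWeight,
    ENNReal.ofReal_mul (sq_nonneg p), ENNReal.ofReal_pow hp.le, ENNReal.ofReal_pow (by linarith)]

lemma measurableSet_obstacle (m : ℝ≥0) : MeasurableSet {V : ℤ → ℝ≥0 | V 0 = m} := by
  have h : {V : ℤ → ℝ≥0 | V 0 = m} = (fun V : ℤ → ℝ≥0 => V 0) ⁻¹' {m} := by ext; simp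
  rw [h]
  exact measurable_pi_apply 0 (measurableSet_singleton m)

lemma fieldLaw_obstacle {p : ℝ} (hp : 0 < p) (hp1 : p ≤ 1) {m : ℝ≥0} (hm : m ≠ 0) :
    fieldLaw p m {V | V 0 = m} = ENNReal.ofReal p := by
  have := isProbabilityMeasure_siteLaw hp hp1 m
  have h : {V : ℤ → ℝ≥0 | V 0 = m} = (fun V : ℤ → ℝ≥0 => V 0) ⁻¹' {m} := by ext; simp
  rw [fieldLaw, h, ← siteLaw_obstacle p hm]
  exact (measurePreserving_eval_infinitePi (fun _ : ℤ => siteLaw p m) 0).measure_preimage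
    (measurableSet_singleton m).nullMeasurableSet

/-- Decomposition of an integral according to the obstacles nearest to `0`. -/
lemma lintegral_fieldLaw {p : ℝ} (hp : 0 < p) (hp1 : p ≤ 1) {m : ℝ≥0} (hm : m ≠ 0)
    (g : (ℤ → ℝ≥0) → ℝ≥0∞) :
    ∫⁻ V, g V ∂(fieldLaw p m) = ∫⁻ V in {V | V 0 = m}, g V ∂(fieldLaw p m) +
      ∑' q : ℕ × ℕ, ∫⁻ V in gapEvent m q, g V ∂(fieldLaw p m) := by
  have := isProbabilityMeasure_siteLaw hp hp1 m
  have hprob : IsProbabilityMeasure (fieldLaw p m) := by unfold fieldLaw; infer_instance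
  have hU : MeasurableSet (⋃ q, gapEvent m q) :=
    MeasurableSet.iUnion fun q => measurableSet_gapEvent m q
  have hdisj : Disjoint {V : ℤ → ℝ≥0 | V 0 = m} (⋃ q, gapEvent m q) := by
    refine Set.disjoint_left.2 fun V h h' => ?_
    obtain ⟨q, hq⟩ := mem_iUnion.1 h'
    have h0 : V 0 = m := h
    exact hm (h0.symm.trans (apply_of_mem_gapEvent hq (by omega) (by omega)))
  -- The masses add up to `p + (1 - p) = 1`, so the almost sure existence of an obstacle on each
  -- side needs no separate argument.
  have hfull : fieldLaw p m ({V | V 0 = m} ∪ ⋃ q, gapEvent m q) = 1 := by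
    rw [measure_union hdisj hU, fieldLaw_obstacle hp hp1 hm,
      measure_iUnion (pairwise_disjoint_gapEvent hm) (measurableSet_gapEvent m),
      tsum_congr fun q => fieldLaw_gapEvent hp hp1 hm q, tsum_gapWeight hp hp1,
      ← ENNReal.ofReal_add hp.le (by linarith)]
    simp
  have hae : ∀ᵐ V ∂(fieldLaw p m), V ∈ {V | V 0 = m} ∪ ⋃ q, gapEvent m q :=
    (prob_compl_eq_zero_iff ((measurableSet_obstacle m).union hU)).2 hfull
  rw [← lintegral_iUnion (measurableSet_gapEvent m) (pairwise_disjoint_gapEvent hm),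
    ← lintegral_union hU hdisj, Measure.restrict_eq_self_of_ae_mem hae]

/-! ### Two-sided bounds for the expected Green function -/

section Rates

variable {m : ℝ≥0} {q : ℕ × ℕ} {V : ℤ → ℝ≥0}

lemma rate_of_eq_zero {x : ℤ} (h : V x = 0) : rate V x = 1 / 2 := by simp [rate, h]

lemma rate_of_eq {x : ℤ} (h : V x = m) : rate V x = Real.exp (-(m : ℝ)) / 2 := by rw [rate, h]

lemma exp_neg_lt_one (hm : m ≠ 0) : Real.exp (-(m : ℝ)) < 1 := by
  rw [Real.exp_lt_one_iff]
  have : (0 : ℝ) < m := by positivity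
  linarith

lemma greenSum_le_of_mem_gapEvent (hm : m ≠ 0) (h : V ∈ gapEvent m q) :
    greenSum (rate V) ≤ ENNReal.ofReal
      (2 * ((q.1 : ℝ) + 1) * ((q.2 : ℝ) + 1) / ((q.1 : ℝ) + 1 + ((q.2 : ℝ) + 1))) +
        ENNReal.ofReal (Real.exp (-(m : ℝ)) / (1 - Real.exp (-(m : ℝ)))) := by
  have ha1 := exp_neg_lt_one hm
  refine (greenSum_le_of_run (isRate_rate V) (Real.exp_pos _) ha1
    (rate_of_eq_zero (apply_of_mem_gapEvent h (by omega) (by omega)))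
    (fun k hk => rate_of_eq_zero (apply_of_mem_gapEvent h (by omega) (by omega)))
    (rate_of_eq (apply_left_of_mem_gapEvent h))
    (fun k hk => rate_of_eq_zero (apply_of_mem_gapEvent h (by omega) (by omega)))
    (rate_of_eq (apply_right_of_mem_gapEvent h))).trans ENNReal.ofReal_add_le

lemma le_greenSum_of_mem_gapEvent (h : V ∈ gapEvent m q) :
    ENNReal.ofReal
      (2 * ((q.1 : ℝ) + 1) * ((q.2 : ℝ) + 1) / ((q.1 : ℝ) + 1 + ((q.2 : ℝ) + 1))) ≤
      greenSum (rate V) :=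
  le_greenSum_of_run (isRate_rate V)
    (rate_of_eq_zero (apply_of_mem_gapEvent h (by omega) (by omega)))
    (fun k hk => rate_of_eq_zero (apply_of_mem_gapEvent h (by omega) (by omega)))
    (fun k hk => rate_of_eq_zero (apply_of_mem_gapEvent h (by omega) (by omega)))

end Rates

/-- The limiting inverse speed for hard obstacles. -/
def hardCost (p : ℝ) : ℝ := (2 - p + 2 * p ^ 2) / (3 * p)

lemma hardCost_pos {p : ℝ} (hp : 0 < p) : 0 < hardCost p :=
  div_pos (by nlinarith [sq_nonneg (p - 1 / 4)]) (by positivity)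

lemma hardCost_eq {p : ℝ} (hp : 0 < p) : hardCost p = p + (1 - p) * (2 + p) / (3 * p) := by
  rw [hardCost]
  field_simp
  ring

lemma hardCost_le_lintegral_greenSum {p : ℝ} (hp : 0 < p) (hp1 : p ≤ 1) {m : ℝ≥0} (hm : m ≠ 0) :
    ENNReal.ofReal (hardCost p) ≤ ∫⁻ V, greenSum (rate V) ∂(fieldLaw p m) := by
  have hq : 0 ≤ (1 - p) * (2 + p) / (3 * p) :=
    div_nonneg (mul_nonneg (by linarith) (by linarith)) (by linarith)
  rw [lintegral_fieldLaw hp hp1 hm, hardCost_eq hp, ENNReal.ofReal_add hp.le hq,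
    ← tsum_harmonicMean_gapWeight hp hp1]
  refine add_le_add ?_ (ENNReal.tsum_le_tsum fun q => ?_)
  · calc ENNReal.ofReal p = ∫⁻ _ in {V : ℤ → ℝ≥0 | V 0 = m}, 1 ∂(fieldLaw p m) := by
          rw [setLIntegral_const, one_mul, fieldLaw_obstacle hp hp1 hm]
      _ ≤ _ := setLIntegral_mono' (measurableSet_obstacle m)
          fun V _ => one_le_greenSum (isRate_rate V)
  · rw [← fieldLaw_gapEvent hp hp1 hm, ← setLIntegral_const]
    exact setLIntegral_mono' (measurableSet_gapEvent m q)
      fun V hV => le_greenSum_of_mem_gapEvent hV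

/-- Softness costs the same `a / (1 - a)` in both cases: on the gap events by the harmonic mean
bound, at an obstacle because `1 / (1 - a) = 1 + a / (1 - a)`. The probabilities `p` and `1 - p`
then combine into a single error term. This bound also provides the integrability needed for the
ergodic theorem. -/
lemma lintegral_greenSum_le {p : ℝ} (hp : 0 < p) (hp1 : p ≤ 1) {m : ℝ≥0} (hm : m ≠ 0) :
    ∫⁻ V, greenSum (rate V) ∂(fieldLaw p m) ≤
      ENNReal.ofReal (hardCost p + Real.exp (-(m : ℝ)) / (1 - Real.exp (-(m : ℝ)))) := by
  have ha1 := exp_neg_lt_one hm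
  have ha0 := Real.exp_pos (-(m : ℝ))
  set a := Real.exp (-(m : ℝ))
  have hq : 0 ≤ (1 - p) * (2 + p) / (3 * p) :=
    div_nonneg (mul_nonneg (by linarith) (by linarith)) (by linarith)
  have hd : 0 ≤ a / (1 - a) := div_nonneg ha0.le (by linarith)
  have hB : ∫⁻ V in {V | V 0 = m}, greenSum (rate V) ∂(fieldLaw p m) ≤
      ENNReal.ofReal (1 / (1 - a)) * ENNReal.ofReal p := by
    rw [← fieldLaw_obstacle hp hp1 hm, ← setLIntegral_const]
    exact setLIntegral_mono' (measurableSet_obstacle m) fun V hV =>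
      greenSum_le_of_obstacle (isRate_rate V) ha0 ha1 (rate_of_eq hV)
  have hA : ∑' q : ℕ × ℕ, ∫⁻ V in gapEvent m q, greenSum (rate V) ∂(fieldLaw p m) ≤
      ENNReal.ofReal ((1 - p) * (2 + p) / (3 * p)) +
        ENNReal.ofReal (a / (1 - a)) * ENNReal.ofReal (1 - p) := by
    rw [← tsum_harmonicMean_gapWeight hp hp1, ← tsum_gapWeight hp hp1, ← ENNReal.tsum_mul_left,
      ← ENNReal.tsum_add]
    refine ENNReal.tsum_le_tsum fun q => ?_
    rw [← add_mul, ← fieldLaw_gapEvent hp hp1 hm, ← setLIntegral_const]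
    exact setLIntegral_mono' (measurableSet_gapEvent m q)
      fun V hV => greenSum_le_of_mem_gapEvent hm hV
  rw [lintegral_fieldLaw hp hp1 hm]
  refine (add_le_add hB hA).trans_eq ?_
  have h1a : 0 < 1 - a := by linarith
  have hp1' : 0 ≤ 1 - p := by linarith
  rw [← ENNReal.ofReal_mul (by positivity), ← ENNReal.ofReal_mul hd,
    ← ENNReal.ofReal_add hq (by positivity), ← ENNReal.ofReal_add (by positivity) (by positivity),
    hardCost_eq hp]
  congr 1
  field_simp
  ring

/-! ### The quenched speed -/

/-- The inverse of the quenched speed. -/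
def invSpeed (p M : ℝ) : ℝ :=
  (∫⁻ V, crossTime (rate V) 0 ∂(fieldLaw p M.toNNReal)).toReal

section

variable {p M : ℝ}

lemma toNNReal_ne_zero (hM : 0 < M) : M.toNNReal ≠ 0 := (Real.toNNReal_pos.2 hM).ne'

lemma lintegral_crossTime_fieldLaw (hp : 0 < p) (hp1 : p ≤ 1) (m : ℝ≥0) :
    ∫⁻ V, crossTime (rate V) 0 ∂(fieldLaw p m) = ∫⁻ V, greenSum (rate V) ∂(fieldLaw p m) := by
  have := isProbabilityMeasure_siteLaw hp hp1 m
  exact lintegral_crossTime_eq (siteLaw p m)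

lemma lintegral_crossTime_ne_top (hp : 0 < p) (hp1 : p ≤ 1) (hM : 0 < M) :
    ∫⁻ V, crossTime (rate V) 0 ∂(fieldLaw p M.toNNReal) ≠ ∞ := by
  rw [lintegral_crossTime_fieldLaw hp hp1]
  exact ((lintegral_greenSum_le hp hp1 (toNNReal_ne_zero hM)).trans_lt ENNReal.ofReal_lt_top).ne

lemma hardCost_le_invSpeed (hp : 0 < p) (hp1 : p ≤ 1) (hM : 0 < M) :
    hardCost p ≤ invSpeed p M := by
  refine (ENNReal.ofReal_le_iff_le_toReal (lintegral_crossTime_ne_top hp hp1 hM)).1 ?_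
  rw [lintegral_crossTime_fieldLaw hp hp1]
  exact hardCost_le_lintegral_greenSum hp hp1 (toNNReal_ne_zero hM)

lemma invSpeed_le (hp : 0 < p) (hp1 : p ≤ 1) (hM : 0 < M) :
    invSpeed p M ≤ hardCost p + Real.exp (-M) / (1 - Real.exp (-M)) := by
  have h := lintegral_greenSum_le hp hp1 (toNNReal_ne_zero hM)
  have ha := exp_neg_lt_one (toNNReal_ne_zero hM)
  rw [Real.coe_toNNReal M hM.le] at h ha
  refine ENNReal.toReal_le_of_le_ofReal
    (add_nonneg (hardCost_pos hp).le (div_nonneg (Real.exp_pos _).le (by linarith))) ?_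
  rw [lintegral_crossTime_fieldLaw hp hp1]
  exact h

lemma invSpeed_pos (hp : 0 < p) (hp1 : p ≤ 1) (hM : 0 < M) : 0 < invSpeed p M :=
  (hardCost_pos hp).trans_le (hardCost_le_invSpeed hp hp1 hM)

lemma IsBernoulliPotential.map_eq_siteLaw {Ω : Type*} [MeasurableSpace Ω] {P : Measure Ω}
    [IsProbabilityMeasure P] {V : ℤ → Ω → ℝ≥0} (h : IsBernoulliPotential P V p M) (hp : 0 < p)
    (hp1 : p ≤ 1) (hM : 0 < M) (x : ℤ) : P.map (V x) = siteLaw p M.toNNReal := by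
  set m := M.toNNReal
  have hm : m ≠ 0 := toNNReal_ne_zero hM
  have hmM : (m : ℝ) = M := Real.coe_toNNReal M hM.le
  have hV := h.measurable x
  have h1 : P.map (V x) {m} = ENNReal.ofReal p := by
    rw [Measure.map_apply hV (measurableSet_singleton m), ← h.prob_eq x]
    congr 1
    ext ω
    simp [← hmM]
  have h2 : P.map (V x) {0} = ENNReal.ofReal (1 - p) := by
    rw [Measure.map_apply hV (measurableSet_singleton 0), ← h.prob_zero x]
    congr 1
  have hdisj : Disjoint ({m} : Set ℝ≥0) {0} := by simpa using hm
  have hprob : IsProbabilityMeasure (P.map (V x)) :=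
    Measure.isProbabilityMeasure_map hV.aemeasurable
  have hfull : P.map (V x) ({m} ∪ {0}) = 1 := by
    rw [measure_union hdisj (measurableSet_singleton 0), h1, h2,
      ← ENNReal.ofReal_add hp.le (by linarith)]
    simp
  have hms : MeasurableSet ({m} ∪ {0} : Set ℝ≥0) :=
    (measurableSet_singleton m).union (measurableSet_singleton 0)
  have hae : ∀ᵐ y ∂(P.map (V x)), y ∈ ({m} ∪ {0} : Set ℝ≥0) :=
    (prob_compl_eq_zero_iff hms).2 hfull
  rw [← Measure.restrict_eq_self_of_ae_mem hae,
    Measure.restrict_union hdisj (measurableSet_singleton 0), Measure.restrict_singleton,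
    Measure.restrict_singleton, h1, h2, siteLaw]

lemma IsBernoulliPotential.map_eq_fieldLaw {Ω : Type*} [MeasurableSpace Ω] {P : Measure Ω}
    [IsProbabilityMeasure P] {V : ℤ → Ω → ℝ≥0} (h : IsBernoulliPotential P V p M) (hp : 0 < p)
    (hp1 : p ≤ 1) (hM : 0 < M) : P.map (fun ω x => V x ω) = fieldLaw p M.toNNReal := by
  rw [(iIndepFun_iff_map_fun_eq_infinitePi_map h.measurable).1 h.indep, fieldLaw]
  congr 1
  ext1 x
  exact h.map_eq_siteLaw hp hp1 hM x

lemma isBernoulliQuenchedSpeed_invSpeed (hp : 0 < p) (hp1 : p ≤ 1) (hM : 0 < M) :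
    IsBernoulliQuenchedSpeed.{u} p M (1 / invSpeed p M) := by
  intro Ω _ P _ V hV
  have := isProbabilityMeasure_siteLaw hp hp1 M.toNNReal
  have hfin := lintegral_crossTime_ne_top hp hp1 hM
  refine ⟨one_div_pos.2 (invSpeed_pos hp hp1 hM), ?_⟩
  have hmeas : Measurable fun (ω : Ω) (x : ℤ) => V x ω := measurable_pi_iff.2 hV.measurable
  have h : ∀ᵐ W ∂(P.map fun ω x => V x ω),
      Tendsto (fun y : ℕ => meanCrossingTime W y / (y : ℝ≥0∞)) atTop
        (𝓝 (∫⁻ V, crossTime (rate V) 0 ∂(fieldLaw p M.toNNReal))) := by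
    rw [hV.map_eq_fieldLaw hp hp1 hM]
    exact ae_tendsto_meanCrossingTime (siteLaw p M.toNNReal) hfin
  rw [one_div_one_div, invSpeed, ENNReal.ofReal_toReal hfin]
  exact ae_of_ae_map hmeas.aemeasurable h

/-- Without a realization in the given universe, being a quenched speed would be vacuous and
uniqueness would fail. `ULift` carries the product space into `Type u`. -/
lemma exists_isBernoulliPotential (hp : 0 < p) (hp1 : p ≤ 1) (hM : 0 < M) :
    ∃ (Ω : Type u) (_ : MeasurableSpace Ω) (P : Measure Ω) (_ : IsProbabilityMeasure P)
      (V : ℤ → Ω → ℝ≥0), IsBernoulliPotential P V p M := by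
  set m := M.toNNReal
  have hm : m ≠ 0 := toNNReal_ne_zero hM
  have hmM : (m : ℝ) = M := Real.coe_toNNReal M hM.le
  have := isProbabilityMeasure_siteLaw hp hp1 m
  have hprob : IsProbabilityMeasure (fieldLaw p m) := by unfold fieldLaw; infer_instance
  have hup : Measurable (ULift.up : (ℤ → ℝ≥0) → ULift.{u} (ℤ → ℝ≥0)) := measurable_up
  have hV : ∀ x : ℤ, Measurable fun ω : ULift.{u} (ℤ → ℝ≥0) => ω.down x := fun x =>
    (measurable_pi_apply x).comp measurable_down
  have hsite : ∀ x : ℤ, ((fieldLaw p m).map ULift.up).map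
      (fun ω : ULift.{u} (ℤ → ℝ≥0) => ω.down x) = siteLaw p m := fun x => by
    rw [Measure.map_map (hV x) hup]
    exact Measure.infinitePi_map_eval (fun _ : ℤ => siteLaw p m) x
  refine ⟨ULift.{u} (ℤ → ℝ≥0), inferInstance, (fieldLaw p m).map ULift.up,
    Measure.isProbabilityMeasure_map hup.aemeasurable, fun x ω => ω.down x,
    { measurable := hV, indep := ?_, prob_eq := fun x => ?_, prob_zero := fun x => ?_ }⟩
  · have : IsProbabilityMeasure ((fieldLaw p m).map (ULift.up.{u})) :=
      Measure.isProbabilityMeasure_map hup.aemeasurable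
    rw [iIndepFun_iff_map_fun_eq_infinitePi_map hV,
      Measure.map_map (measurable_pi_iff.2 hV) hup]
    simp only [hsite]
    exact Measure.map_id
  · rw [← siteLaw_obstacle p hm, ← hsite x,
      Measure.map_apply (hV x) (measurableSet_singleton m)]
    congr 1
    ext ω
    simp [← hmM]
  · rw [← siteLaw_free p hm, ← hsite x, Measure.map_apply (hV x) (measurableSet_singleton 0)]
    congr 1

lemma IsQuenchedSpeed.unique {Ω : Type*} [MeasurableSpace Ω] {P : Measure Ω}
    [IsProbabilityMeasure P] {V : ℤ → Ω → ℝ≥0} {v w : ℝ} (hv : IsQuenchedSpeed P V v)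
    (hw : IsQuenchedSpeed P V w) : v = w := by
  obtain ⟨ω, h1, h2⟩ := (hv.2.and hw.2).exists
  have h := tendsto_nhds_unique h1 h2
  rw [ENNReal.ofReal_eq_ofReal_iff (one_div_pos.2 hv.1).le (one_div_pos.2 hw.1).le,
    one_div, one_div] at h
  exact inv_injective h

lemma IsBernoulliQuenchedSpeed.eq_one_div {v : ℝ} (hv : IsBernoulliQuenchedSpeed.{u} p M v)
    (hp : 0 < p) (hp1 : p ≤ 1) (hM : 0 < M) : v = 1 / invSpeed p M := by
  obtain ⟨Ω, _, P, _, V, hV⟩ := exists_isBernoulliPotential.{u} hp hp1 hM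
  exact (hv Ω P V hV).unique (isBernoulliQuenchedSpeed_invSpeed.{u} hp hp1 hM Ω P V hV)

/-! ### Asymptotics -/

lemma half_inv_le_hardCost (hp : 0 < p) : 1 / (2 * p) ≤ hardCost p := by
  rw [hardCost, div_le_div_iff₀ (by positivity) (by positivity)]
  nlinarith [sq_nonneg (p - 1 / 4), mul_pos hp hp, mul_nonneg hp.le (sq_nonneg (p - 1 / 4))]

/-- The cost of softness of the obstacles. -/
def softCost (M : ℝ) : ℝ := Real.exp (-M) / (1 - Real.exp (-M))

lemma softCost_anti {M₀ : ℝ} (hM₀ : 0 < M₀) (h : M₀ ≤ M) : softCost M ≤ softCost M₀ := by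
  have h1 : Real.exp (-M) ≤ Real.exp (-M₀) := Real.exp_le_exp.2 (by linarith)
  have h2 : Real.exp (-M₀) < 1 := Real.exp_lt_one_iff.2 (by linarith)
  exact div_le_div₀ (Real.exp_pos _).le h1 (by linarith) (by linarith)

lemma tendsto_softCost : Tendsto softCost atTop (𝓝 0) := by
  have h : Tendsto (fun M : ℝ => Real.exp (-M)) atTop (𝓝 0) :=
    Real.tendsto_exp_atBot.comp tendsto_neg_atTop_atBot
  have h2 := h.div (tendsto_const_nhds.sub h) (a := 0) (b := (1 : ℝ) - 0) (by norm_num)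
  rw [sub_zero, zero_div] at h2
  exact h2

/-- Since `invSpeed p M ≥ 1/(2p)`, dividing by it costs at most a factor `2p`. This factor drives
the limit `p → 0` and is harmless for `p ≤ 1`. -/
lemma abs_sub_one_le_of_sub_le (hp : 0 < p) (hp1 : p ≤ 1) (hM : 0 < M) {c e : ℝ}
    (h : |c - invSpeed p M| ≤ e) : |c / invSpeed p M - 1| ≤ 2 * p * e := by
  have hpos := invSpeed_pos hp hp1 hM
  have hle := (half_inv_le_hardCost hp).trans (hardCost_le_invSpeed hp hp1 hM)
  rw [div_le_iff₀ (by positivity)] at hle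
  have e1 : c / invSpeed p M - 1 = (c - invSpeed p M) / invSpeed p M := by
    field_simp
  rw [e1, abs_div, abs_of_pos hpos, div_le_iff₀ hpos]
  have he : 0 ≤ e := (abs_nonneg _).trans h
  nlinarith

lemma abs_hardCost_sub_invSpeed_le (hp : 0 < p) (hp1 : p ≤ 1) (hM : 0 < M) :
    |hardCost p - invSpeed p M| ≤ softCost M := by
  have h1 := hardCost_le_invSpeed hp hp1 hM
  have h2 : invSpeed p M ≤ hardCost p + softCost M := invSpeed_le hp hp1 hM
  rw [abs_sub_le_iff]
  constructor <;> linarith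

lemma abs_two_div_sub_hardCost_le (hp : 0 < p) (hp1 : p ≤ 1) :
    |2 / (3 * p) - hardCost p| ≤ 1 := by
  have e : 2 / (3 * p) - hardCost p = (1 - 2 * p) / 3 := by
    rw [hardCost]; field_simp; ring
  rw [e, abs_le]
  constructor <;> linarith

end

end

end CrossingSpeed

open CrossingSpeed in
theorem theorem1p1 :
    -- the quenched speed is well defined, positive and finite
    (∀ p ∈ Set.Ioc (0 : ℝ) 1, ∀ M : ℝ, 0 < M →
      ∃! v : ℝ, CrossingSpeed.IsBernoulliQuenchedSpeed.{u} p M v) ∧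
    ∀ v : ℝ → ℝ → ℝ,
      (∀ p ∈ Set.Ioc (0 : ℝ) 1, ∀ M : ℝ, 0 < M →
        CrossingSpeed.IsBernoulliQuenchedSpeed.{u} p M (v p M)) →
      -- `v p M ∼ 3p/2` as `p → 0`, uniformly in `M ∈ [M₀, ∞)`, for every `M₀ > 0`
      (∀ M₀ : ℝ, 0 < M₀ →
        TendstoUniformlyOn (fun p M : ℝ => v p M / (3 * p / 2)) (fun _ => 1)
          (nhdsWithin 0 (Set.Ioi 0)) (Set.Ici M₀)) ∧
      -- `v p M ∼ 3p/(2-p+2p²)` as `M → ∞`, locally uniformly in `p ∈ (0, 1]`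
      TendstoLocallyUniformlyOn (fun M p : ℝ => v p M / (3 * p / (2 - p + 2 * p ^ 2)))
        (fun _ => 1) Filter.atTop (Set.Ioc 0 1) := by
  refine ⟨fun p hp M hM => ⟨_, isBernoulliQuenchedSpeed_invSpeed hp.1 hp.2 hM,
    fun v hv => hv.eq_one_div hp.1 hp.2 hM⟩, fun v hv => ⟨fun M₀ hM₀ => ?_, ?_⟩⟩
  · rw [Metric.tendstoUniformlyOn_iff]
    intro ε hε
    -- In the relative error `2p(1 + softCost M₀)`, the `1` bounds the distance from `2/(3p)` to
    -- `hardCost p`, and `softCost M₀` bounds the softness error for all `M ≥ M₀`.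
    have hlim : Filter.Tendsto (fun p : ℝ => 2 * p * (1 + softCost M₀)) (nhdsWithin 0 (Set.Ioi 0))
        (nhds 0) := by
      have h : Continuous fun p : ℝ => 2 * p * (1 + softCost M₀) := by fun_prop
      simpa using (h.tendsto 0).mono_left nhdsWithin_le_nhds
    filter_upwards [hlim.eventually_lt_const hε, self_mem_nhdsWithin,
      mem_nhdsWithin_of_mem_nhds (Iic_mem_nhds (show (0 : ℝ) < 1 by norm_num))]
      with p hp hp0 hp1 M hM
    have hp0 : 0 < p := hp0
    have hp1 : p ≤ 1 := hp1
    have hM : M₀ ≤ M := hM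
    have hM0 : 0 < M := hM₀.trans_le hM
    rw [dist_comm, Real.dist_eq, (hv p ⟨hp0, hp1⟩ M hM0).eq_one_div hp0 hp1 hM0]
    have hpos := invSpeed_pos hp0 hp1 hM0
    have e : 1 / invSpeed p M / (3 * p / 2) = 2 / (3 * p) / invSpeed p M := by field_simp
    rw [e]
    refine (abs_sub_one_le_of_sub_le hp0 hp1 hM0 (e := 1 + softCost M₀) ?_).trans_lt hp
    refine (abs_sub_le _ (hardCost p) _).trans (add_le_add (abs_two_div_sub_hardCost_le hp0 hp1) ?_)
    exact (abs_hardCost_sub_invSpeed_le hp0 hp1 hM0).trans (softCost_anti hM₀ hM)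
  -- The convergence is in fact uniform on all of `(0, 1]`: the relative error is at most `2p *
  -- softCost M ≤ 2 * softCost M`.
  · refine TendstoUniformlyOn.tendstoLocallyUniformlyOn ?_
    rw [Metric.tendstoUniformlyOn_iff]
    intro ε hε
    have hlim : Filter.Tendsto (fun M : ℝ => 2 * softCost M) Filter.atTop (nhds 0) := by
      simpa using tendsto_softCost.const_mul 2
    filter_upwards [hlim.eventually_lt_const hε, Filter.eventually_gt_atTop 0] with M hM hM0 p hp
    rw [dist_comm, Real.dist_eq, (hv p hp M hM0).eq_one_div hp.1 hp.2 hM0]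
    have hp0 := hp.1
    have hpos := invSpeed_pos hp0 hp.2 hM0
    have e : 1 / invSpeed p M / (3 * p / (2 - p + 2 * p ^ 2)) = hardCost p / invSpeed p M := by
      have : 0 < 2 - p + 2 * p ^ 2 := by nlinarith [sq_nonneg (p - 1 / 4)]
      rw [hardCost]
      field_simp
    rw [e]
    have hs := abs_hardCost_sub_invSpeed_le hp0 hp.2 hM0
    refine (abs_sub_one_le_of_sub_le hp0 hp.2 hM0 hs).trans_lt (lt_of_le_of_lt ?_ hM)
    have hs0 := (abs_nonneg _).trans hs
    nlinarith [hp.2]
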